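/- **Setting (Borda dueling bandits with knapsacks).** There are $K\ge 2$ items, $d$ resources, a horizon $T\ge 1$ and a budget $0<B\le 2T$ for every resource. The instance consists of a preference matrix $P\in[0,1]^{K\times K}$ with $P(i,j)+P(j,i)=1$ for all $i,j$, and a law of random duel outcomes and consumption vectors: in each round $t=1,\dots,T$, independently of the past, $o_t(i,j)\sim\mathrm{Ber}(P(i,j))$ for every pair $(i,j)$ and $u_t(i)\in[0,1]^d$ with mean $v(i)$ for every item $i$ (identically distributed over the rounds, possibly correlated within a round). The learner picks items $x_t,y_t$ and observes $o_t=o_t(x_t,y_t)$, $u_t(x_t)$, $u_t(y_t)$. The Borda score of $i$ is $b(i)=\frac1{K-1}\sum_{j\ne i}P(i,j)$. The benchmark is $$\mathrm{OPT}=T\cdot\max_{\pi}\Big\{\textstyle\sum_x b(x)\pi(x)+\sum_y b(y)\pi(y)\Big\},$$ over the probability distributions $\pi$ on the items with $\sum_x v(x)\pi(x)+\sum_y v(y)\pi(y)\le\frac BT\mathbf 1$; this program is assumed feasible. The reward $\mathrm{REW}$ is the sum of $b(x_t)+b(y_t)$ over the rounds $t\le T$ such that the total consumption $\sum_{s\le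 t}(u_s(x_s)+u_s(y_s))$ is at most $B$ in every resource, and the regret is $R(T)=\mathrm{OPT}-\mathbb E[\mathrm{REW}]$. **Algorithm (Vigilant D-EXP3 / B-DBwK EXP-3).** The parameters are $Z>0$, $\eta>0$, $\gamma\in(0,1)$ and a procedure for online convex optimization (OCO). In round $t$ the algorithm draws $x_t,y_t$ independently from $q_t$, where $q_1$ is uniform, and forms for every item $i$ $$\hat s_t(i)=\frac{\mathbf 1(x_t=i)}{K q_t(i)}\sum_{j}\frac{\mathbf 1(y_t=j)\,o_t}{q_t(j)},\qquad \hat v^1_t(i)=\mathbf 1-\frac{\mathbf 1(x_t=i)}{q_t(i)}(\mathbf 1-u_t(x_t)),\qquad \hat v^2_t(i)=\mathbf 1-\frac{\mathbf 1(y_t=i)}{q_t(i)}(\mathbf 1-u_t(y_t)),$$ $$\hat\ell_t(i)=2\hat s_t(i)+Z\,\lambda_t^{\top}\Big[\frac BT\mathbf 1-(\hat v^1_t(i)+\hat v^2_t(i))\Big],\qquad q_{t+1}(i)=(1-\gamma)\frac{\exp(\eta\sum_{s\le t}\hat\ell_s(i))}{\sum_j\exp(\eta\sum_{s\le t}\hat\ell_s(j))}+\frac{\gamma}{K}.$$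 The dual vectors $\lambda_t\in\{\lambda\ge 0:\sum_r\lambda_r\le 1\}$ are chosen by the OCO procedure (a deterministic measurable function of the past losses), run on the losses $g_t(\lambda)=\langle\lambda,\frac BT\mathbf 1-(u_t(x_t)+u_t(y_t))\rangle$. The procedure is any one whose regret up to every time $n\le T$, on every sequence of linear losses with coefficients in $[-2,2]$ and against every fixed $\lambda$ in this domain, is at most $c_0\sqrt{T\log(d+1)}$ (for example exponentiated gradient, with $c_0=8$). **Theorem.** For all $\kappa\ge 1$ and $c_0>0$ there are $C>0$ and $p\in\mathbb N$, depending on nothing else, such that the following holds. If $\frac{\mathrm{OPT}}B\le Z\le\kappa\frac{\mathrm{OPT}}B$, $Z>0$, $$\eta=\Big(\frac{\log K}{T\sqrt K}\Big)^{2/3}\frac1Z,\qquad \gamma=\sqrt{\eta K}<1,$$ then the algorithm satisfies $$R(T)\le C\,\big(\log(T+d+1)\big)^p\;\frac{\mathrm{OPT}}B\,(K\log K)^{2/3}\,T^{2/3},$$ that is, $R(T)\le\tilde{\mathcal O}\big(\frac{\mathrm{OPT}}B(K\log K)^{2/3}T^{2/3}\big)$. -/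

import Mathlib

open MeasureTheory

noncomputable section

namespace BordaDBwK

/-! ### The problem: Borda dueling bandits with knapsacks -/

/-- The outcomes of one round, before the learner reveals part of them: the result of the duel of
every ordered pair of items, and the consumption vector (over `d` resources) of every item. -/
abbrev Outcome (K d : ℕ) : Type := (Fin K → Fin K → Bool) × (Fin K → Fin d → ℝ)

/-- A stochastic instance with `K` items and `d` resources: a preference matrix, and the law of the
outcomes of one round. The duel of `(i, j)` is a Bernoulli variable with mean `pref i j`; the
consumptions are random vectors in `[0,1]^d`. Duels and consumptions may be correlated. -/
structure Instance (K d : ℕ) where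
  pref : Fin K → Fin K → ℝ
  law : Measure (Outcome K d)
  isProb : IsProbabilityMeasure law
  pref_add : ∀ i j, pref i j + pref j i = 1
  pref_law : ∀ i j, law.real {e | e.1 i j = true} = pref i j
  consumption_mem : ∀ᵐ e ∂law, ∀ i r, e.2 i r ∈ Set.Icc (0 : ℝ) 1

variable {K d : ℕ}

/-- Borda score `b(i) = (1/(K-1)) ∑_{j ≠ i} P(i,j)`. -/
def Instance.borda (E : Instance K d) (i : Fin K) : ℝ :=
  (∑ j ∈ Finset.univ.erase i, E.pref i j) / ((K : ℝ) - 1)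

/-- Mean consumption `v(i)` of item `i`, for resource `r`. -/
def Instance.meanConsumption (E : Instance K d) (i : Fin K) (r : Fin d) : ℝ :=
  ∫ e, e.2 i r ∂E.law

/-- The feasible set of the benchmark linear program: distributions `π` on the items such that a
pair of items drawn from `π` consumes at most `B/T` of each resource on average. -/
def Instance.feasible (E : Instance K d) (B : ℝ) (T : ℕ) : Set (Fin K → ℝ) :=
  {p | (∀ i, 0 ≤ p i) ∧ ∑ i, p i = 1 ∧
    ∀ r, ∑ i, E.meanConsumption i r * p i + ∑ i, E.meanConsumption i r * p i ≤ B / T}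

/-- The benchmark `OPT`: `T` times the value of the linear program with the Borda scores. -/
def Instance.opt (E : Instance K d) (B : ℝ) (T : ℕ) : ℝ :=
  T * sSup ((fun p : Fin K → ℝ => ∑ i, E.borda i * p i + ∑ i, E.borda i * p i) '' E.feasible B T)

/-! ### Online convex optimization on `{λ ≥ 0, ∑ λ ≤ 1}` with linear losses -/

/-- The domain of the dual variables. -/
def dualSet (d : ℕ) : Set (Fin d → ℝ) := {l | (∀ r, 0 ≤ l r) ∧ ∑ r, l r ≤ 1}

/-- A (deterministic, non-anticipating) OCO procedure: it maps the loss vectors of the past `n`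
rounds to the next point of the domain. The loss of `l` against the vector `c` is `∑ r, l r * c r`. -/
structure OCO (d : ℕ) where
  play : (n : ℕ) → (Fin n → Fin d → ℝ) → Fin d → ℝ
  play_mem : ∀ n c, play n c ∈ dualSet d
  measurable_play : ∀ n, Measurable (play n)

/-- The procedure has regret at most `c₀ √(T log (d+1))` at every time up to `T`, on every sequence
of loss vectors with entries in `[-2, 2]`, against every fixed point of the domain. -/
def OCO.HasRegret (A : OCO d) (T : ℕ) (c₀ : ℝ) : Prop :=
  ∀ c : ℕ → Fin d → ℝ, (∀ t r, |c t r| ≤ 2) → ∀ n ≤ T, ∀ l ∈ dualSet d,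
    ∑ t ∈ Finset.range n, ∑ r, A.play t (fun s => c s) r * c t r
      - ∑ t ∈ Finset.range n, ∑ r, l r * c t r ≤ c₀ * √(T * Real.log (d + 1))

/-- Exponentiated gradient with step `a`, with one extra coordinate of loss `0` for the slack
`1 - ∑ λ`: a standard OCO procedure. -/
def expGrad (d : ℕ) (a : ℝ) : OCO d where
  play n c r := Real.exp (-a * ∑ s, c s r) / (1 + ∑ k, Real.exp (-a * ∑ s, c s k))
  play_mem n c := by
    have h : 0 ≤ ∑ k, Real.exp (-a * ∑ s, c s k) :=
      Finset.sum_nonneg fun k _ => (Real.exp_pos _).le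
    refine ⟨fun r => by positivity, ?_⟩
    rw [← Finset.sum_div, div_le_one (by linarith)]
    linarith
  measurable_play n := by
    refine measurable_pi_lambda _ fun r => ?_
    fun_prop

/-- The class of OCO procedures with regret `8 √(T log (d+1))` is not empty. -/
theorem expGrad_hasRegret (d T : ℕ) :
    (expGrad d √(Real.log (d + 1) / T)).HasRegret T 8 := by
  intro c hc n hn l hl
  rcases Nat.eq_zero_or_pos n with rfl | hn0
  · simp; positivity
  rcases Nat.eq_zero_or_pos d with rfl | hd
  · simp
  have hT : (0 : ℝ) < T := by exact_mod_cast lt_of_lt_of_le hn0 hn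
  have hnT : (n : ℝ) ≤ T := by exact_mod_cast hn
  have hd' : (1 : ℝ) ≤ d := by exact_mod_cast hd
  set L := Real.log ((d : ℝ) + 1) with hL
  have hLpos : 0 < L := Real.log_pos (by linarith)
  set a := √(L / T) with ha
  have hapos : 0 < a := Real.sqrt_pos.2 (by positivity)
  have ha2 : a ^ 2 * T = L := by
    rw [ha, Real.sq_sqrt (by positivity)]; field_simp
  have hR : √(T * L) = a * T := by
    rw [show (T : ℝ) * L = (a * T) ^ 2 by rw [← ha2]; ring, Real.sqrt_sq (by positivity)]
  rw [hR]
  set lam : ℕ → Fin d → ℝ := fun t => (expGrad d a).play t (fun s => c s) with hlam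
  have hmem : ∀ t, lam t ∈ dualSet d := fun t => (expGrad d a).play_mem t _
  have hbd : ∀ q ∈ dualSet d, ∀ t, |∑ r, q r * c t r| ≤ 2 := by
    intro q hq t
    calc |∑ r, q r * c t r| ≤ ∑ r, |q r * c t r| := Finset.abs_sum_le_sum_abs _ _
      _ ≤ ∑ r, q r * 2 := by
          refine Finset.sum_le_sum fun r _ => ?_
          rw [abs_mul, abs_of_nonneg (hq.1 r)]
          exact mul_le_mul_of_nonneg_left (hc t r) (hq.1 r)
      _ = (∑ r, q r) * 2 := by rw [Finset.sum_mul]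
      _ ≤ 2 := by linarith [hq.2]
  by_cases hsmall : a * 2 ≤ 1
  · set G : ℕ → Fin d → ℝ := fun t r => ∑ s ∈ Finset.range t, c s r with hG
    set Φ : ℕ → ℝ := fun t => 1 + ∑ k, Real.exp (-a * G t k) with hΦ
    have hΦ1 : ∀ t, 1 ≤ Φ t := fun t =>
      le_add_of_nonneg_right (Finset.sum_nonneg fun k _ => (Real.exp_pos _).le)
    have hlamG : ∀ t r, lam t r = Real.exp (-a * G t r) / Φ t := by
      intro t r
      simp only [hlam, expGrad, hΦ, hG, Finset.sum_range]
    have hstep : ∀ t, Φ (t + 1) ≤ Φ t * Real.exp (-a * (∑ r, lam t r * c t r) + 4 * a ^ 2) := by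
      intro t
      have hΦp : 0 < Φ t := lt_of_lt_of_le one_pos (hΦ1 t)
      have hexp : ∀ r, Real.exp (-a * c t r) ≤ 1 + -a * c t r + 4 * a ^ 2 := by
        intro r
        have h1 : |-a * c t r| ≤ 1 := by
          rw [abs_mul, abs_neg, abs_of_pos hapos]
          nlinarith [hc t r]
        have h2 := Real.abs_exp_sub_one_sub_id_le h1
        have h3 : (-a * c t r) ^ 2 ≤ 4 * a ^ 2 := by
          have h4 : c t r ^ 2 ≤ 2 ^ 2 := sq_le_sq' (by linarith [(abs_le.1 (hc t r)).1])
            (abs_le.1 (hc t r)).2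
          rw [mul_pow, neg_sq]
          nlinarith [sq_nonneg a]
        linarith [(abs_le.1 h2).2]
      have hkey : Φ (t + 1) ≤ Φ t * (1 + -a * (∑ r, lam t r * c t r) + 4 * a ^ 2) := by
        have hsum : ∑ k, Real.exp (-a * G (t + 1) k) ≤
            ∑ k, Real.exp (-a * G t k) * (1 + -a * c t k + 4 * a ^ 2) := by
          refine Finset.sum_le_sum fun k _ => ?_
          have : -a * G (t + 1) k = -a * G t k + -a * c t k := by
            simp only [hG, Finset.sum_range_succ]; ring
          rw [this, Real.exp_add]
          exact mul_le_mul_of_nonneg_left (hexp k) (Real.exp_pos _).le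
        have hlc : Φ t * ∑ r, lam t r * c t r = ∑ r, Real.exp (-a * G t r) * c t r := by
          rw [Finset.mul_sum]
          refine Finset.sum_congr rfl fun r _ => ?_
          rw [hlamG]; field_simp
        have hexpand : ∑ k, Real.exp (-a * G t k) * (1 + -a * c t k + 4 * a ^ 2) =
            (1 + 4 * a ^ 2) * (∑ k, Real.exp (-a * G t k))
              - a * ∑ k, Real.exp (-a * G t k) * c t k := by
          rw [Finset.mul_sum, Finset.mul_sum, ← Finset.sum_sub_distrib]
          refine Finset.sum_congr rfl fun r _ => ?_
          ring
        have e1 : Φ (t + 1) = 1 + ∑ k, Real.exp (-a * G (t + 1) k) := rfl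
        have e2 : ∑ k, Real.exp (-a * G t k) = Φ t - 1 := by simp [hΦ]
        rw [hexpand, e2, ← hlc] at hsum
        rw [e1]
        nlinarith [sq_nonneg a]
      refine hkey.trans (mul_le_mul_of_nonneg_left ?_ hΦp.le)
      have := Real.add_one_le_exp (-a * (∑ r, lam t r * c t r) + 4 * a ^ 2)
      linarith
    have hlog : ∀ t, Real.log (Φ t) ≤
        L - a * (∑ s ∈ Finset.range t, ∑ r, lam s r * c s r) + 4 * a ^ 2 * t := by
      intro t
      induction t with
      | zero => simp [hΦ, hG, hL, add_comm]
      | succ t ih =>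
        have hΦp : 0 < Φ t := lt_of_lt_of_le one_pos (hΦ1 t)
        have h1 := Real.log_le_log (lt_of_lt_of_le one_pos (hΦ1 (t + 1))) (hstep t)
        rw [Real.log_mul hΦp.ne' (Real.exp_pos _).ne', Real.log_exp] at h1
        rw [Finset.sum_range_succ]
        push_cast
        linarith
    have hlow : -a * (∑ s ∈ Finset.range n, ∑ r, l r * c s r) ≤ Real.log (Φ n) := by
      have hr : ∀ r, -a * G n r ≤ Real.log (Φ n) := by
        intro r
        rw [Real.le_log_iff_exp_le (lt_of_lt_of_le one_pos (hΦ1 n))]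
        have := Finset.single_le_sum (f := fun k => Real.exp (-a * G n k))
          (fun k _ => (Real.exp_pos _).le) (Finset.mem_univ r)
        simp only [hΦ]
        linarith
      have h0 : 0 ≤ Real.log (Φ n) := Real.log_nonneg (hΦ1 n)
      have e : -a * (∑ s ∈ Finset.range n, ∑ r, l r * c s r) = ∑ r, l r * (-a * G n r) := by
        rw [Finset.sum_comm, Finset.mul_sum]
        refine Finset.sum_congr rfl fun r _ => ?_
        simp only [hG]
        rw [← Finset.mul_sum]; ring
      rw [e]
      calc ∑ r, l r * (-a * G n r) ≤ ∑ r, l r * Real.log (Φ n) :=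
            Finset.sum_le_sum fun r _ => mul_le_mul_of_nonneg_left (hr r) (hl.1 r)
        _ = (∑ r, l r) * Real.log (Φ n) := by rw [Finset.sum_mul]
        _ ≤ Real.log (Φ n) := by nlinarith [hl.2]
    have hfin := hlow.trans (hlog n)
    have h5 : 4 * a ^ 2 * n ≤ 4 * a ^ 2 * T := mul_le_mul_of_nonneg_left hnT (by positivity)
    refine le_of_mul_le_mul_left ?_ hapos
    nlinarith [mul_pos hapos hapos]
  · push Not at hsmall
    have h1 : ∑ t ∈ Finset.range n, ∑ r, lam t r * c t r ≤ n * 2 := by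
      have := Finset.sum_le_card_nsmul (Finset.range n) (fun t => ∑ r, lam t r * c t r) 2
        (fun t _ => (abs_le.1 (hbd _ (hmem t) t)).2)
      simpa using this
    have h2 : -(n * 2 : ℝ) ≤ ∑ t ∈ Finset.range n, ∑ r, l r * c t r := by
      have := Finset.card_nsmul_le_sum (Finset.range n) (fun t => ∑ r, l r * c t r) (-2)
        (fun t _ => (abs_le.1 (hbd _ hl t)).1)
      simpa using this
    have h3 : (T : ℝ) * 4 ≤ 8 * (a * T) := by nlinarith
    linarith

/-! ### The algorithm -/

/-- What the learner sees in one round: the two items, the result of their duel, and the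
consumption vectors of the two items. -/
structure Feedback (K d : ℕ) where
  x : Fin K
  y : Fin K
  won : Bool
  ux : Fin d → ℝ
  uy : Fin d → ℝ

/-- The feedback of a round with outcome `e` when the pair `(i, j)` is played. -/
def observe (i j : Fin K) (e : Outcome K d) : Feedback K d :=
  ⟨i, j, e.1 i j, e.2 i, e.2 j⟩

/-- The parameters of the algorithm. -/
structure Params (d : ℕ) where
  eta : ℝ
  gamma : ℝ
  Z : ℝ
  B : ℝ
  T : ℕ
  oco : OCO d

/-- Indicator of `a = b`. -/
def ind {α : Type*} [DecidableEq α] (a b : α) : ℝ := if a = b then 1 else 0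

/-- `ŝ(i) = 1(x = i) / (K q(i)) · ∑_j 1(y = j) o / q(j)`. -/
def scoreEst (q : Fin K → ℝ) (f : Feedback K d) (i : Fin K) : ℝ :=
  ind f.x i / (K * q i) * ∑ j, ind f.y j * ind f.won true / q j

/-- `v̂¹(i) = 1 - 1(x = i) / q(i) · (1 - u(x))`. -/
def consEst₁ (q : Fin K → ℝ) (f : Feedback K d) (i : Fin K) (r : Fin d) : ℝ :=
  1 - ind f.x i / q i * (1 - f.ux r)

/-- `v̂²(i) = 1 - 1(y = i) / q(i) · (1 - u(y))`. -/
def consEst₂ (q : Fin K → ℝ) (f : Feedback K d) (i : Fin K) (r : Fin d) : ℝ :=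
  1 - ind f.y i / q i * (1 - f.uy r)

/-- The estimated Lagrangian `ℓ̂(i) = 2 ŝ(i) + Z λᵀ [(B/T) 1 - (v̂¹(i) + v̂²(i))]`. -/
def lagrangianEst (a : Params d) (q : Fin K → ℝ) (l : Fin d → ℝ) (f : Feedback K d)
    (i : Fin K) : ℝ :=
  2 * scoreEst q f i + a.Z * ∑ r, l r * (a.B / a.T - (consEst₁ q f i r + consEst₂ q f i r))

/-- Exponential weights at rate `η` on the cumulative estimates `S`, mixed with the uniform
distribution with weight `γ`. -/
def sampling (a : Params d) (S : Fin K → ℝ) (i : Fin K) : ℝ :=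
  (1 - a.gamma) * (Real.exp (a.eta * S i) / ∑ j, Real.exp (a.eta * S j)) + a.gamma / K

/-- The loss vector `(B/T) 1 - (u(x) + u(y))` handed to the OCO procedure after a round; its loss
function is `g(λ) = ⟨λ, (B/T) 1 - (u(x) + u(y))⟩`. -/
def dualLoss (a : Params d) (f : Feedback K d) (r : Fin d) : ℝ :=
  a.B / a.T - (f.ux r + f.uy r)

/-- `λ_t`, computed from the feedback `h s` of the rounds `s < t`. -/
def dual (a : Params d) (h : ℕ → Feedback K d) (t : ℕ) : Fin d → ℝ :=
  a.oco.play t (fun s => dualLoss a (h s))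

/-- `∑_{s < t} ℓ̂_s(i)`, computed from the feedback of the rounds `s < t`. -/
def cumEst (a : Params d) (h : ℕ → Feedback K d) : ℕ → Fin K → ℝ
  | 0 => 0
  | t + 1 => cumEst a h t +
      lagrangianEst a (sampling a (cumEst a h t)) (dual a h t) (h t)

/-- The sampling distribution `q_t` of round `t` (rounds are numbered from `0`), computed from the
feedback of the rounds `s < t`. -/
def policy (a : Params d) (h : ℕ → Feedback K d) (t : ℕ) : Fin K → ℝ :=
  sampling a (cumEst a h t)

/-! ### The interaction, its reward, and its regret -/

variable {Ω : Type*} [MeasurableSpace Ω]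

/-- The feedback sequence along a sample path, when `(x t, y t)` is played and `z t` is the outcome
of round `t`. -/
def feedback (x y : ℕ → Ω → Fin K) (z : ℕ → Ω → Outcome K d) (ω : Ω) (t : ℕ) : Feedback K d :=
  observe (x t ω) (y t ω) (z t ω)

/-- The σ-algebra generated by everything that happened before round `t`. -/
abbrev past (x y : ℕ → Ω → Fin K) (z : ℕ → Ω → Outcome K d) (t : ℕ) : MeasurableSpace Ω :=
  MeasurableSpace.comap (fun ω (s : Fin t) => (x s ω, y s ω, z s ω)) inferInstance

/-- `(x, y, z)` is a run of the algorithm with parameters `a` on the instance `E` under `μ`: in each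
round `t < T`, conditionally on the past, the items `x t` and `y t` have law `q_t`, the outcome
`z t` has law `E.law`, and the three are independent. -/
structure IsRun (E : Instance K d) (a : Params d) (μ : Measure Ω)
    (x y : ℕ → Ω → Fin K) (z : ℕ → Ω → Outcome K d) : Prop where
  measurable_x : ∀ t, Measurable (x t)
  measurable_y : ∀ t, Measurable (y t)
  measurable_z : ∀ t, Measurable (z t)
  cond_law : ∀ t < a.T, ∀ H : Set Ω, MeasurableSet[past x y z t] H →
    ∀ (i j : Fin K) (A : Set (Outcome K d)), MeasurableSet A →
      μ.real (H ∩ {ω | x t ω = i ∧ y t ω = j ∧ z t ω ∈ A}) =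
        E.law.real A *
          ∫ ω in H, policy a (feedback x y z ω) t i * policy a (feedback x y z ω) t j ∂μ

/-- The budget still suffices after round `t`: the total consumption of the rounds `0, …, t` is at
most `B` for every resource. -/
def WithinBudget (B : ℝ) (h : ℕ → Feedback K d) (t : ℕ) : Prop :=
  ∀ r, ∑ s ∈ Finset.range (t + 1), ((h s).ux r + (h s).uy r) ≤ B

open Classical in
/-- Total Borda reward of the rounds played before some budget is exceeded. -/
def reward (E : Instance K d) (B : ℝ) (T : ℕ) (h : ℕ → Feedback K d) : ℝ :=
  ∑ t ∈ Finset.range T,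
    if WithinBudget B h t then E.borda (h t).x + E.borda (h t).y else 0

/-- Expected regret `OPT - E[REW]`. -/
def regret (E : Instance K d) (a : Params d) (μ : Measure Ω)
    (x y : ℕ → Ω → Fin K) (z : ℕ → Ω → Outcome K d) : ℝ :=
  E.opt a.B a.T - ∫ ω, reward E a.B a.T (feedback x y z ω) ∂μ

end BordaDBwK

end

/-!
The proof compares a potential argument on each sample path with the conditional means of the rounds.

*Estimates.* Given the past, the estimate `ŝ(i)` has mean `s(i) = (1/K) ∑_j P(i,j)`, an increasing
affine function of the Borda score (`Instance.fullScore_eq`), and `ℓ̂(i)` has the Lagrangian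
`2 s(i) + Z λᵀ [(B/T) 1 - 2 v(i)]` as its mean (`roundMean_lagrangianEst`). The second moments are
at most of order `K/γ + Z² K`. For `η K = γ²` and `γ Z ≤ 1` the values `η ℓ̂` are at most `4`, which
is what the second-order bound of exponential weights needs (`expWeights_regret`).

*Primal-dual argument.* Everything is stopped at the end of the first round in which a budget is
exceeded. Whether a round is played is then decided by its past, so the identities for conditional
means apply (`IsRun.integral_feedback`, an iterated integral over the past and a fresh outcome). The
dual player competes with the multiplier of an exhausted resource, or with `0`; in both cases its
loss is at most its regret less `B (1 - n/T)`, `n` being the number of rounds played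
(`sum_dual_loss_le`). Since `Z B ≥ OPT`, this pays for the rounds that are lost, and the regret is of
order `log K / η + T (γ + γ Z + (γ Z)²) + Z √(T log (d+1))` (`IsRun.le_meanScore`,
`IsRun.regret_le`).

*Parameters.* With `u = (K log K)^(1/3)` and `s = T^(1/3)` one has `γ² Z s² = u²`, and the claimed
bound is of order `Z u² s²`. If `B ≤ 2 κ u² s²`, then `R(T) ≤ OPT` suffices; otherwise `γ Z ≤ 1`. The
terms `γ T` and `γ Z T` are of the right order only if `Z` is bounded below by a constant. If it is
not, `OPT ≤ Z B` is a small fraction of `B`, while the reward is at least a constant fraction of `B`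
up to the other error terms: the constraints weigh at most `2 Z` in the Lagrangian, some item has
Borda score at least `1/2`, at least `B/2` rounds are played, and if `γ` is not small then
exploration alone earns `γ` per round (`IsRun.regret_le_of_Z_small`).
-/

noncomputable section

namespace BordaDBwK

variable {K d : ℕ}

/-! ### Exponential weights -/

/-- The quadratic bound has no lower restriction on `x`, so very negative gains are harmless. The
constant `81 = 3 ^ 4` bounds `exp 4`. -/
theorem exp_le_quadratic {x : ℝ} (hx : x ≤ 4) : Real.exp x ≤ 1 + x + 81 * x ^ 2 := by
  rcases le_or_gt (|x|) 1 with h | h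
  · have := (abs_le.1 (Real.abs_exp_sub_one_sub_id_le h)).2
    nlinarith [sq_nonneg x]
  rcases le_or_gt x 0 with h0 | h0
  · have h1 : Real.exp x ≤ 1 := Real.exp_le_one_iff.2 h0
    rw [abs_of_nonpos h0] at h
    nlinarith
  · rw [abs_of_pos h0] at h
    have h1 : Real.exp x ≤ Real.exp 4 := Real.exp_le_exp.2 hx
    have h2 : Real.exp 4 = Real.exp 1 ^ 4 := by rw [← Real.exp_nat_mul]; norm_num
    have h3 : Real.exp 1 ^ 4 ≤ 3 ^ 4 :=
      pow_le_pow_left₀ (Real.exp_pos 1).le (by linarith [Real.exp_one_lt_d9]) 4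
    nlinarith

/-- The exponential weights `exp (η S i) / ∑ j, exp (η S j)`. -/
def expWeights (η : ℝ) (S : Fin K → ℝ) (i : Fin K) : ℝ :=
  Real.exp (η * S i) / ∑ j, Real.exp (η * S j)

theorem expWeights_nonneg (η : ℝ) (S : Fin K → ℝ) (i : Fin K) : 0 ≤ expWeights η S i := by
  unfold expWeights; positivity

theorem sum_exp_pos (hK : 0 < K) (f : Fin K → ℝ) : 0 < ∑ j, Real.exp (f j) :=
  Finset.sum_pos (fun _ _ => Real.exp_pos _) ⟨⟨0, hK⟩, Finset.mem_univ _⟩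

theorem sum_expWeights (hK : 0 < K) (η : ℝ) (S : Fin K → ℝ) : ∑ i, expWeights η S i = 1 := by
  unfold expWeights
  rw [← Finset.sum_div, div_self (sum_exp_pos hK _).ne']

/-- Second-order regret bound of exponential weights. Only an upper bound on `η` times the gains is
needed: the potential `log ∑ exp (η S)` grows by at most the linear and the quadratic term. -/
theorem expWeights_regret (hK : 0 < K) {η : ℝ} (hη : 0 < η) (g : ℕ → Fin K → ℝ)
    (S : ℕ → Fin K → ℝ) (hS0 : S 0 = 0) (hS : ∀ t, S (t + 1) = S t + g t) (n : ℕ)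
    (hg : ∀ t < n, ∀ i, η * g t i ≤ 4) (p : Fin K → ℝ) (hp : ∀ i, 0 ≤ p i) (hp1 : ∑ i, p i = 1) :
    ∑ t ∈ Finset.range n, ∑ i, (p i - expWeights η (S t) i) * g t i ≤
      Real.log K / η +
        81 * η * ∑ t ∈ Finset.range n, ∑ i, expWeights η (S t) i * g t i ^ 2 := by
  set Φ : ℕ → ℝ := fun t => ∑ j, Real.exp (η * S t j) with hΦ
  have hΦp : ∀ t, 0 < Φ t := fun t => sum_exp_pos hK _
  have hstep : ∀ t < n, Real.log (Φ (t + 1)) ≤ Real.log (Φ t) +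
      (η * ∑ i, expWeights η (S t) i * g t i +
        81 * η ^ 2 * ∑ i, expWeights η (S t) i * g t i ^ 2) := by
    intro t ht
    set X := η * ∑ i, expWeights η (S t) i * g t i +
        81 * η ^ 2 * ∑ i, expWeights η (S t) i * g t i ^ 2 with hX
    have h1 : Φ (t + 1) ≤ Φ t * (1 + X) := by
      have e : Φ t * (1 + X) =
          ∑ i, Real.exp (η * S t i) * (1 + η * g t i + 81 * (η * g t i) ^ 2) := by
        have hw : ∀ i, Real.exp (η * S t i) = Φ t * expWeights η (S t) i := by
          intro i
          unfold expWeights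
          rw [mul_div_cancel₀ _ (hΦp t).ne']
        have h1 := sum_expWeights hK η (S t)
        calc Φ t * (1 + X) = Φ t * (∑ i, expWeights η (S t) i + X) := by rw [h1]
          _ = _ := by
            rw [hX, Finset.mul_sum, Finset.mul_sum, ← Finset.sum_add_distrib,
              ← Finset.sum_add_distrib, Finset.mul_sum]
            refine Finset.sum_congr rfl fun i _ => ?_
            rw [hw]; ring
      rw [e]
      refine Finset.sum_le_sum fun i _ => ?_
      rw [hS, Pi.add_apply, mul_add, Real.exp_add]
      exact mul_le_mul_of_nonneg_left (exp_le_quadratic (hg t ht i)) (Real.exp_pos _).le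
    have h2 : Φ (t + 1) ≤ Φ t * Real.exp X :=
      h1.trans (mul_le_mul_of_nonneg_left (by linarith [Real.add_one_le_exp X]) (hΦp t).le)
    have h3 := Real.log_le_log (hΦp _) h2
    rwa [Real.log_mul (hΦp t).ne' (Real.exp_pos _).ne', Real.log_exp] at h3
  have hsum : ∀ m ≤ n, Real.log (Φ m) ≤ Real.log K + ∑ t ∈ Finset.range m,
      (η * ∑ i, expWeights η (S t) i * g t i +
        81 * η ^ 2 * ∑ i, expWeights η (S t) i * g t i ^ 2) := by
    intro m
    induction m with
    | zero => intro _; simp [hΦ, hS0]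
    | succ m ih =>
      intro hm
      rw [Finset.sum_range_succ]
      linarith [ih (by omega), hstep m (by omega)]
  have hSn : ∀ m i, S m i = ∑ t ∈ Finset.range m, g t i := by
    intro m i
    induction m with
    | zero => simp [hS0]
    | succ m ih => rw [hS, Pi.add_apply, ih, Finset.sum_range_succ]
  have hlow : η * ∑ t ∈ Finset.range n, ∑ i, p i * g t i ≤ Real.log (Φ n) := by
    have h1 : ∀ i, η * S n i ≤ Real.log (Φ n) := by
      intro i
      rw [Real.le_log_iff_exp_le (hΦp n)]
      exact Finset.single_le_sum (f := fun j => Real.exp (η * S n j))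
        (fun j _ => (Real.exp_pos _).le) (Finset.mem_univ i)
    calc η * ∑ t ∈ Finset.range n, ∑ i, p i * g t i = ∑ i, p i * (η * S n i) := by
          rw [Finset.sum_comm, Finset.mul_sum]
          refine Finset.sum_congr rfl fun i _ => ?_
          rw [hSn, ← Finset.mul_sum]; ring
      _ ≤ ∑ i, p i * Real.log (Φ n) :=
          Finset.sum_le_sum fun i _ => mul_le_mul_of_nonneg_left (h1 i) (hp i)
      _ = Real.log (Φ n) := by rw [← Finset.sum_mul, hp1, one_mul]
  have hfin := hlow.trans (hsum n le_rfl)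
  rw [Finset.sum_add_distrib, ← Finset.mul_sum, ← Finset.mul_sum] at hfin
  have e : ∑ t ∈ Finset.range n, ∑ i, (p i - expWeights η (S t) i) * g t i =
      ∑ t ∈ Finset.range n, ∑ i, p i * g t i -
        ∑ t ∈ Finset.range n, ∑ i, expWeights η (S t) i * g t i := by
    simp only [sub_mul, Finset.sum_sub_distrib]
  rw [e]
  refine le_of_mul_le_mul_left ?_ hη
  have e2 : η * (Real.log K / η) = Real.log K := by field_simp
  rw [mul_add, e2]
  linarith

/-! ### Stopping at the first failure of a decreasing family of events -/

open Classical in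
/-- The index at which a decreasing sequence of properties first fails, capped at `T`. -/
theorem exists_stop (A : ℕ → Prop) (hA0 : A 0) (hA : ∀ t, A (t + 1) → A t) (T : ℕ) :
    ∃ n ≤ T, (∀ t < n, A t) ∧ (n < T → ¬ A n) ∧ (0 < T → 0 < n) ∧
      ∀ X : ℕ → ℝ, ∑ t ∈ Finset.range T, (if A t then (1 : ℝ) else 0) * X t =
        ∑ t ∈ Finset.range n, X t := by
  have hmono : ∀ s t, s ≤ t → A t → A s := by
    intro s t hst
    induction hst with
    | refl => exact id
    | step _ ih => exact fun h => ih (hA _ h)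
  induction T with
  | zero => exact ⟨0, le_rfl, by simp, by simp, by simp, by simp⟩
  | succ T ih =>
    obtain ⟨n, hn, h1, h2, h3, h4⟩ := ih
    by_cases hAT : A T
    · refine ⟨T + 1, le_rfl, fun t ht => hmono t T (by omega) hAT, by simp, by simp, fun X => ?_⟩
      refine Finset.sum_congr rfl fun t ht => ?_
      rw [if_pos (hmono t T (by simp at ht; omega) hAT), one_mul]
    · refine ⟨n, by omega, h1, fun _ => ?_, fun _ => ?_, fun X => ?_⟩
      · rcases hn.lt_or_eq with h | rfl
        · exact h2 h
        · exact hAT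
      · rcases Nat.eq_zero_or_pos T with rfl | hT
        · exact absurd hA0 hAT
        · exact h3 hT
      · rw [Finset.sum_range_succ, h4, if_neg hAT]; simp

/-! ### Integrating out a variable that is independent of the past -/

/-- If, on the event `S`, the pair `(f, g)` has the law of density `w` with respect to the product
of the law of `f` and `ρ`, then integrals over `S` of functions of `(f, g)` are iterated. -/
theorem setIntegral_eq_integral_mul_integral {Ω X Y : Type*} [MeasurableSpace Ω]
    [MeasurableSpace X] [MeasurableSpace Y] (μ : Measure Ω) [IsFiniteMeasure μ] (ρ : Measure Y)
    [IsProbabilityMeasure ρ] {f : Ω → X} {g : Ω → Y} (hf : Measurable f) (hg : Measurable g)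
    {S : Set Ω} {w : X → ℝ} (hw : Measurable w) (hw0 : ∀ x, 0 ≤ w x)
    (hw1 : ∀ x, w x ≤ 1)
    (h : ∀ H, MeasurableSet H → ∀ A, MeasurableSet A →
      μ.real (f ⁻¹' H ∩ (S ∩ g ⁻¹' A)) = ρ.real A * ∫ ω in f ⁻¹' H, w (f ω) ∂μ)
    {F : X × Y → ℝ} (hF : Measurable F) {C : ℝ} (hC : ∀ᵐ y ∂ρ, ∀ x, |F (x, y)| ≤ C) :
    ∫ ω in S, F (f ω, g ω) ∂μ = ∫ ω, w (f ω) * ∫ y, F (f ω, y) ∂ρ ∂μ := by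
  have hwE : Measurable fun x => ENNReal.ofReal (w x) := hw.ennreal_ofReal
  set ν : Measure X := (μ.map f).withDensity fun x => ENNReal.ofReal (w x) with hν
  have hνH : ∀ H, MeasurableSet H → ν H = ENNReal.ofReal (∫ ω in f ⁻¹' H, w (f ω) ∂μ) := by
    intro H hH
    rw [hν, withDensity_apply _ hH, setLIntegral_map hH hwE hf,
      ofReal_integral_eq_lintegral_ofReal]
    · refine Integrable.of_bound (hw.comp hf).aestronglyMeasurable 1 (ae_of_all _ fun ω => ?_)
      rw [Real.norm_of_nonneg (hw0 _)]; exact hw1 _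
    · exact ae_of_all _ fun ω => hw0 _
  have : IsFiniteMeasure ν := ⟨by rw [hνH _ MeasurableSet.univ]; exact ENNReal.ofReal_lt_top⟩
  have hprod : ν.prod ρ = (μ.restrict S).map fun ω => (f ω, g ω) := by
    refine Measure.prod_eq fun H A hH hA => ?_
    rw [Measure.map_apply (hf.prodMk hg) (hH.prod hA),
      Measure.restrict_apply ((hf.prodMk hg) (hH.prod hA)), hνH H hH]
    have e : (fun ω => (f ω, g ω)) ⁻¹' (H ×ˢ A) ∩ S = f ⁻¹' H ∩ (S ∩ g ⁻¹' A) := by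
      ext ω; simp only [Set.mem_inter_iff, Set.mem_preimage, Set.mem_prod]; tauto
    rw [e, ← ofReal_measureReal (s := f ⁻¹' H ∩ (S ∩ g ⁻¹' A)), h H hH A hA,
      ENNReal.ofReal_mul measureReal_nonneg, ofReal_measureReal, mul_comm]
  have hint : Integrable F (ν.prod ρ) := by
    refine Integrable.of_bound hF.aestronglyMeasurable C ?_
    have : ∀ᵐ p ∂ν.prod ρ, ∀ x, |F (x, p.2)| ≤ C :=
      Measure.quasiMeasurePreserving_snd.ae hC
    filter_upwards [this] with p hp using hp p.1
  have h1 : ∫ ω in S, F (f ω, g ω) ∂μ = ∫ p, F p ∂(ν.prod ρ) := by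
    rw [hprod, integral_map (hf.prodMk hg).aemeasurable hF.aestronglyMeasurable]
  rw [h1, integral_prod _ hint, hν, integral_withDensity_eq_integral_toReal_smul hwE
    (ae_of_all _ fun _ => ENNReal.ofReal_lt_top), integral_map hf.aemeasurable]
  · refine integral_congr_ae (ae_of_all _ fun ω => ?_)
    simp [ENNReal.toReal_ofReal (hw0 _)]
  · refine (hwE.ennreal_toReal.smul ?_).aestronglyMeasurable
    exact (StronglyMeasurable.integral_prod_right' hF.stronglyMeasurable).measurable

/-! ### The instance: mean duel outcomes, scores and consumptions -/

theorem Instance.pref_nonneg (E : Instance K d) (i j : Fin K) : 0 ≤ E.pref i j := by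
  rw [← E.pref_law]; exact measureReal_nonneg

theorem Instance.pref_le_one (E : Instance K d) (i j : Fin K) : E.pref i j ≤ 1 := by
  linarith [E.pref_add i j, E.pref_nonneg j i]

/-- The score `(1/K) ∑_j P(i,j)`, with the term `j = i` included: this is what `ŝ(i)` estimates
without bias. It is an increasing affine function of the Borda score. -/
def Instance.fullScore (E : Instance K d) (i : Fin K) : ℝ := (∑ j, E.pref i j) / K

theorem Instance.fullScore_eq (E : Instance K d) (hK : 2 ≤ K) (i : Fin K) :
    E.fullScore i = ((K : ℝ) - 1) / K * E.borda i + 1 / (2 * K) := by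
  have hK' : (2 : ℝ) ≤ K := by exact_mod_cast hK
  have h1 : E.pref i i = 1 / 2 := by linarith [E.pref_add i i]
  have h2 := Finset.sum_erase_add Finset.univ (E.pref i) (Finset.mem_univ i)
  unfold Instance.fullScore Instance.borda
  rw [← h2, h1]
  have h3 : (K : ℝ) - 1 ≠ 0 := by linarith
  field_simp

theorem Instance.fullScore_nonneg (E : Instance K d) (i : Fin K) : 0 ≤ E.fullScore i :=
  div_nonneg (Finset.sum_nonneg fun _ _ => E.pref_nonneg _ _) (Nat.cast_nonneg _)

theorem Instance.fullScore_le_one (E : Instance K d) (i : Fin K) : E.fullScore i ≤ 1 := by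
  refine div_le_one_of_le₀ ?_ (Nat.cast_nonneg _)
  calc ∑ j, E.pref i j ≤ ∑ _j : Fin K, (1 : ℝ) :=
        Finset.sum_le_sum fun _ _ => E.pref_le_one _ _
    _ = K := by simp

theorem Instance.borda_nonneg (E : Instance K d) (hK : 2 ≤ K) (i : Fin K) : 0 ≤ E.borda i := by
  have hK' : (2 : ℝ) ≤ K := by exact_mod_cast hK
  exact div_nonneg (Finset.sum_nonneg fun _ _ => E.pref_nonneg _ _) (by linarith)

theorem Instance.borda_le_one (E : Instance K d) (hK : 2 ≤ K) (i : Fin K) : E.borda i ≤ 1 := by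
  have hK' : (2 : ℝ) ≤ K := by exact_mod_cast hK
  refine div_le_one_of_le₀ ?_ (by linarith)
  calc ∑ j ∈ Finset.univ.erase i, E.pref i j ≤ ∑ _j ∈ Finset.univ.erase i, (1 : ℝ) :=
        Finset.sum_le_sum fun _ _ => E.pref_le_one _ _
    _ = K - 1 := by
        simp [Finset.card_erase_of_mem, Nat.cast_sub (show 1 ≤ K by omega)]

/-- The Borda scores average to `1/2`, since `P(i,j) + P(j,i) = 1`. -/
theorem Instance.sum_borda (E : Instance K d) (hK : 2 ≤ K) : ∑ i, E.borda i = K / 2 := by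
  have hK' : (2 : ℝ) ≤ K := by exact_mod_cast hK
  have h1 : ∑ i, ∑ j, E.pref i j = (K : ℝ) ^ 2 / 2 := by
    have h2 : ∑ i, ∑ j, E.pref i j = ∑ i, ∑ j, E.pref j i := Finset.sum_comm
    have h3 : ∑ i, ∑ j, E.pref i j + ∑ i, ∑ j, E.pref j i = (K : ℝ) ^ 2 := by
      simp only [← Finset.sum_add_distrib, E.pref_add]
      simp [sq]
    linarith
  have h4 : ∑ i, E.fullScore i = (K : ℝ) / 2 := by
    unfold Instance.fullScore
    rw [← Finset.sum_div, h1]; field_simp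
  simp only [E.fullScore_eq hK, Finset.sum_add_distrib, ← Finset.mul_sum] at h4
  simp only [Finset.sum_const, Finset.card_univ, Fintype.card_fin, nsmul_eq_mul] at h4
  have h5 : (K : ℝ) - 1 ≠ 0 := by linarith
  field_simp at h4
  have h6 : ((K : ℝ) - 1) * (∑ i, E.borda i * 2 - K) = 0 := by
    rw [← Finset.sum_mul]; linarith
  rcases mul_eq_zero.1 h6 with h | h
  · exact absurd h h5
  · rw [← Finset.sum_mul] at h; linarith

theorem Instance.exists_half_le_borda (E : Instance K d) (hK : 2 ≤ K) :
    ∃ i, 1 / 2 ≤ E.borda i := by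
  by_contra! h
  have h1 : ∑ i, E.borda i < ∑ _i : Fin K, (1 / 2 : ℝ) :=
    Finset.sum_lt_sum_of_nonempty ⟨⟨0, by omega⟩, Finset.mem_univ _⟩ fun i _ => h i
  rw [E.sum_borda hK] at h1
  simp at h1
  linarith

theorem ind_nonneg {α : Type*} [DecidableEq α] (a b : α) : 0 ≤ ind a b := by
  unfold ind; split_ifs <;> norm_num

theorem ind_le_one {α : Type*} [DecidableEq α] (a b : α) : ind a b ≤ 1 := by
  unfold ind; split_ifs <;> norm_num

theorem ind_sq {α : Type*} [DecidableEq α] (a b : α) : ind a b ^ 2 = ind a b := by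
  unfold ind; split_ifs <;> norm_num

theorem sum_ind_mul (i : Fin K) (f : Fin K → ℝ) : ∑ j, ind i j * f j = f i := by
  simp [ind]

theorem sum_ind_mul' (i : Fin K) (f : Fin K → ℝ) : ∑ j, ind j i * f j = f i := by
  simp [ind]

theorem measurable_ind_duel (i j : Fin K) :
    Measurable fun e : Outcome K d => ind (e.1 i j) true := by
  have h : Measurable fun b : Bool => ind b true := measurable_of_countable _
  exact h.comp (by fun_prop)

theorem Instance.integrable_duel (E : Instance K d) (i j : Fin K) :
    Integrable (fun e => ind (e.1 i j) true) E.law := by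
  have := E.isProb
  refine Integrable.of_bound (measurable_ind_duel i j).aestronglyMeasurable 1
    (ae_of_all _ fun e => ?_)
  rw [Real.norm_of_nonneg (ind_nonneg _ _)]; exact ind_le_one _ _

theorem Instance.integral_duel (E : Instance K d) (i j : Fin K) :
    ∫ e, ind (e.1 i j) true ∂E.law = E.pref i j := by
  have h : Measurable fun e : Outcome K d => e.1 i j := by fun_prop
  have hm : MeasurableSet {e : Outcome K d | e.1 i j = true} := h (measurableSet_singleton true)
  have e1 : (fun e : Outcome K d => ind (e.1 i j) true) =
      {e : Outcome K d | e.1 i j = true}.indicator 1 := by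
    ext e; simp [ind, Set.indicator_apply]
  rw [e1, integral_indicator_one hm, E.pref_law]

theorem Instance.integrable_consumption (E : Instance K d) (i : Fin K) (r : Fin d) :
    Integrable (fun e => e.2 i r) E.law := by
  have := E.isProb
  refine Integrable.of_bound (by fun_prop) 1 ?_
  filter_upwards [E.consumption_mem] with e he
  rw [Real.norm_of_nonneg (he i r).1]; exact (he i r).2

theorem Instance.meanConsumption_mem (E : Instance K d) (i : Fin K) (r : Fin d) :
    E.meanConsumption i r ∈ Set.Icc (0 : ℝ) 1 := by
  have := E.isProb
  constructor
  · refine integral_nonneg_of_ae ?_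
    filter_upwards [E.consumption_mem] with e he using (he i r).1
  · have h : E.meanConsumption i r ≤ ∫ _e, (1 : ℝ) ∂E.law := by
      refine integral_mono_ae (E.integrable_consumption i r) (integrable_const _) ?_
      filter_upwards [E.consumption_mem] with e he using (he i r).2
    simpa using h

/-! ### One round: bounds on the estimates -/

theorem abs_sum_mul_le_of_mem_dualSet {l : Fin d → ℝ} (hl : l ∈ dualSet d) {c : Fin d → ℝ} {M : ℝ}
    (hM : 0 ≤ M) (hc : ∀ r, |c r| ≤ M) : |∑ r, l r * c r| ≤ M :=
  calc |∑ r, l r * c r| ≤ ∑ r, |l r * c r| := Finset.abs_sum_le_sum_abs _ _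
    _ ≤ ∑ r, l r * M := by
        refine Finset.sum_le_sum fun r _ => ?_
        rw [abs_mul, abs_of_nonneg (hl.1 r)]
        exact mul_le_mul_of_nonneg_left (hc r) (hl.1 r)
    _ = (∑ r, l r) * M := by rw [Finset.sum_mul]
    _ ≤ M := mul_le_of_le_one_left hM hl.2

theorem scoreEst_observe (q : Fin K → ℝ) (i j : Fin K) (e : Outcome K d) (k : Fin K) :
    scoreEst q (observe i j e) k = ind i k / (K * q k) * (ind (e.1 i j) true / q j) := by
  simp only [scoreEst, observe, mul_div_assoc]
  rw [sum_ind_mul]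

/-- The estimated Lagrangian, with the observed part of the consumptions separated. -/
theorem lagrangianEst_observe (a : Params d) (q : Fin K → ℝ) (l : Fin d → ℝ) (i j : Fin K)
    (e : Outcome K d) (k : Fin K) :
    lagrangianEst a q l (observe i j e) k =
      2 * (ind i k / (K * q k) * (ind (e.1 i j) true / q j)) +
        a.Z * (∑ r, l r * (a.B / a.T - 2) + ind i k / q k * ∑ r, l r * (1 - e.2 i r) +
          ind j k / q k * ∑ r, l r * (1 - e.2 j r)) := by
  rw [lagrangianEst, scoreEst_observe, Finset.mul_sum _ _ (ind i k / q k),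
    Finset.mul_sum _ _ (ind j k / q k), ← Finset.sum_add_distrib,
    ← Finset.sum_add_distrib]
  congr 2
  refine Finset.sum_congr rfl fun r _ => ?_
  simp only [consEst₁, consEst₂, observe]
  ring

/-- The outcomes whose consumptions lie in `[0,1]`. -/
def goodOutcomes (K d : ℕ) : Set (Outcome K d) := {e | ∀ i r, e.2 i r ∈ Set.Icc (0 : ℝ) 1}

theorem observed_mem {e : Outcome K d} (he : e ∈ goodOutcomes K d) {l : Fin d → ℝ}
    (hl : l ∈ dualSet d) (i : Fin K) : ∑ r, l r * (1 - e.2 i r) ∈ Set.Icc (0 : ℝ) 1 := by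
  constructor
  · exact Finset.sum_nonneg fun r _ => mul_nonneg (hl.1 r) (by linarith [(he i r).2])
  · refine (le_abs_self _).trans (abs_sum_mul_le_of_mem_dualSet hl zero_le_one fun r => ?_)
    rw [abs_le]; constructor <;> linarith [(he i r).1, (he i r).2]

theorem slack_mem {β : ℝ} (hβ0 : 0 ≤ β) (hβ : β ≤ 2) {l : Fin d → ℝ} (hl : l ∈ dualSet d) :
    ∑ r, l r * (β - 2) ∈ Set.Icc (-2 : ℝ) 0 := by
  constructor
  · refine (abs_le.1 (abs_sum_mul_le_of_mem_dualSet hl zero_le_two fun r => ?_)).1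
    rw [abs_le]; constructor <;> linarith
  · exact Finset.sum_nonpos fun r _ => mul_nonpos_of_nonneg_of_nonpos (hl.1 r) (by linarith)

/-- A bound on `∑_k q(k) ℓ̂(k)²` that depends on the items of the round only. -/
def squareBound (a : Params d) (q : Fin K → ℝ) (i j : Fin K) : ℝ :=
  16 * (1 / ((K : ℝ) ^ 2 * q i * q j ^ 2)) + 16 * a.Z ^ 2 + 4 * a.Z ^ 2 * (1 / q i) +
    4 * a.Z ^ 2 * (1 / q j)

theorem sum_mul_lagrangianEst_sq_le (a : Params d) (hβ0 : 0 ≤ a.B / a.T) (hβ : a.B / a.T ≤ 2)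
    {q : Fin K → ℝ} (hq : ∀ k, 0 < q k) (hq1 : ∑ k, q k = 1) {l : Fin d → ℝ} (hl : l ∈ dualSet d)
    (i j : Fin K) {e : Outcome K d} (he : e ∈ goodOutcomes K d) :
    ∑ k, q k * lagrangianEst a q l (observe i j e) k ^ 2 ≤ squareBound a q i j := by
  have hK : (0 : ℝ) < K := by exact_mod_cast i.pos
  have h : ∀ k, q k * lagrangianEst a q l (observe i j e) k ^ 2 ≤
      ind i k * (16 * (1 / ((K : ℝ) ^ 2 * q k * q j ^ 2))) + q k * (16 * a.Z ^ 2) +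
        ind i k * (4 * a.Z ^ 2 * (1 / q k)) + ind j k * (4 * a.Z ^ 2 * (1 / q k)) := by
    intro k
    rw [lagrangianEst_observe]
    have hk := hq k
    have hj := hq j
    obtain ⟨u0, u1⟩ := observed_mem he hl i
    obtain ⟨v0, v1⟩ := observed_mem he hl j
    obtain ⟨s0, s1⟩ := slack_mem hβ0 hβ hl
    set u := ∑ r, l r * (1 - e.2 i r)
    set v := ∑ r, l r * (1 - e.2 j r)
    set s := ∑ r, l r * (a.B / a.T - 2)
    set x := ind i k
    set y := ind j k
    set o := ind (e.1 i j) true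
    have hx := ind_nonneg i k
    have hy := ind_nonneg j k
    have hx2 : x ^ 2 = x := ind_sq i k
    have hy2 : y ^ 2 = y := ind_sq j k
    have ho2 : o ^ 2 ≤ 1 := by rw [ind_sq]; exact ind_le_one _ _
    have hs2 : s ^ 2 ≤ 4 := by nlinarith
    have hu2 : u ^ 2 ≤ 1 := by nlinarith
    have hv2 : v ^ 2 ≤ 1 := by nlinarith
    have four : ∀ A B C D : ℝ, (A + (B + C + D)) ^ 2 ≤ 4 * (A ^ 2 + B ^ 2 + C ^ 2 + D ^ 2) := by
      intro A B C D
      nlinarith [sq_nonneg (A - B), sq_nonneg (A - C), sq_nonneg (A - D), sq_nonneg (B - C),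
        sq_nonneg (B - D), sq_nonneg (C - D)]
    calc q k * (2 * (x / (K * q k) * (o / q j)) + a.Z * (s + x / q k * u + y / q k * v)) ^ 2
        = q k * (2 * (x / (K * q k) * (o / q j)) +
            (a.Z * s + a.Z * (x / q k * u) + a.Z * (y / q k * v))) ^ 2 := by ring
      _ ≤ q k * (4 * ((2 * (x / (K * q k) * (o / q j))) ^ 2 + (a.Z * s) ^ 2 +
            (a.Z * (x / q k * u)) ^ 2 + (a.Z * (y / q k * v)) ^ 2)) :=
          mul_le_mul_of_nonneg_left (four _ _ _ _) hk.le
      _ = x ^ 2 * (16 * (1 / ((K : ℝ) ^ 2 * q k * q j ^ 2))) * o ^ 2 +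
            q k * (4 * a.Z ^ 2) * s ^ 2 + x ^ 2 * (4 * a.Z ^ 2 * (1 / q k)) * u ^ 2 +
            y ^ 2 * (4 * a.Z ^ 2 * (1 / q k)) * v ^ 2 := by field_simp; ring
      _ ≤ x ^ 2 * (16 * (1 / ((K : ℝ) ^ 2 * q k * q j ^ 2))) * 1 +
            q k * (4 * a.Z ^ 2) * 4 + x ^ 2 * (4 * a.Z ^ 2 * (1 / q k)) * 1 +
            y ^ 2 * (4 * a.Z ^ 2 * (1 / q k)) * 1 := by gcongr
      _ = _ := by rw [hx2, hy2]; ring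
  refine (Finset.sum_le_sum fun k _ => h k).trans (le_of_eq ?_)
  rw [Finset.sum_add_distrib, Finset.sum_add_distrib, Finset.sum_add_distrib, sum_ind_mul,
    sum_ind_mul, sum_ind_mul, ← Finset.sum_mul, hq1, squareBound, one_mul]

/-- Upper bound on the estimated Lagrangian. After multiplication by `η = γ² / K` it becomes
`2 + 2 γ Z`. -/
theorem lagrangianEst_le (a : Params d) (hZ : 0 ≤ a.Z) (hβ0 : 0 ≤ a.B / a.T) (hβ : a.B / a.T ≤ 2)
    (hγ : 0 < a.gamma) {q : Fin K → ℝ} (hq : ∀ k, a.gamma / K ≤ q k) {l : Fin d → ℝ}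
    (hl : l ∈ dualSet d) (i j : Fin K) {e : Outcome K d} (he : e ∈ goodOutcomes K d) (k : Fin K) :
    lagrangianEst a q l (observe i j e) k ≤ 2 * (K / a.gamma ^ 2) + 2 * a.Z * (K / a.gamma) := by
  have hK : (0 : ℝ) < K := by exact_mod_cast i.pos
  have hg : 0 < a.gamma / K := by positivity
  rw [lagrangianEst_observe]
  obtain ⟨u0, u1⟩ := observed_mem he hl i
  obtain ⟨v0, v1⟩ := observed_mem he hl j
  obtain ⟨_, s1⟩ := slack_mem hβ0 hβ hl
  have hk : 0 < q k := hg.trans_le (hq k)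
  have hj : 0 < q j := hg.trans_le (hq j)
  have hinv : ∀ x, 0 ≤ x → x ≤ 1 → x / q k ≤ K / a.gamma := fun x hx0 hx => by
    calc x / q k ≤ 1 / (a.gamma / K) := div_le_div₀ zero_le_one hx hg (hq k)
      _ = K / a.gamma := by field_simp
  have h1 : ind i k / (K * q k) * (ind (e.1 i j) true / q j) ≤ K / a.gamma ^ 2 := by
    calc ind i k / (K * q k) * (ind (e.1 i j) true / q j)
        ≤ 1 / (K * (a.gamma / K)) * (1 / (a.gamma / K)) := by
          have := ind_nonneg i k
          have := ind_nonneg (e.1 i j) true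
          have := ind_le_one i k
          have := ind_le_one (e.1 i j) true
          have := hq k
          have := hq j
          gcongr
      _ = K / a.gamma ^ 2 := by field_simp
  have h2 : ind i k / q k * ∑ r, l r * (1 - e.2 i r) ≤ K / a.gamma :=
    (mul_le_of_le_one_right (div_nonneg (ind_nonneg _ _) hk.le) u1).trans
      (hinv _ (ind_nonneg _ _) (ind_le_one _ _))
  have h3 : ind j k / q k * ∑ r, l r * (1 - e.2 j r) ≤ K / a.gamma :=
    (mul_le_of_le_one_right (div_nonneg (ind_nonneg _ _) hk.le) v1).trans
      (hinv _ (ind_nonneg _ _) (ind_le_one _ _))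
  have h4 := mul_le_mul_of_nonneg_left (add_le_add (add_le_add s1 h2) h3) hZ
  linarith

/-! ### One round: expectations -/

/-- The mean of `G i j` when `i` and `j` are drawn independently from `q`. -/
def pairMean (q : Fin K → ℝ) (G : Fin K → Fin K → ℝ) : ℝ := ∑ i, ∑ j, q i * q j * G i j

theorem pairMean_add (q : Fin K → ℝ) (G H : Fin K → Fin K → ℝ) :
    pairMean q (fun i j => G i j + H i j) = pairMean q G + pairMean q H := by
  simp only [pairMean, mul_add, Finset.sum_add_distrib]

theorem pairMean_const_mul (q : Fin K → ℝ) (c : ℝ) (G : Fin K → Fin K → ℝ) :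
    pairMean q (fun i j => c * G i j) = c * pairMean q G := by
  simp only [pairMean, Finset.mul_sum]
  refine Finset.sum_congr rfl fun i _ => Finset.sum_congr rfl fun j _ => ?_
  ring

theorem pairMean_sub (q : Fin K → ℝ) (G H : Fin K → Fin K → ℝ) :
    pairMean q (fun i j => G i j - H i j) = pairMean q G - pairMean q H := by
  simp only [pairMean, mul_sub, Finset.sum_sub_distrib]

theorem pairMean_sum {ι : Type*} (s : Finset ι) (q : Fin K → ℝ) (G : ι → Fin K → Fin K → ℝ) :
    pairMean q (fun i j => ∑ k ∈ s, G k i j) = ∑ k ∈ s, pairMean q (G k) := by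
  simp only [pairMean, Finset.mul_sum]
  exact (Finset.sum_congr rfl fun i _ => Finset.sum_comm).trans Finset.sum_comm

theorem pairMean_left {q : Fin K → ℝ} (hq1 : ∑ k, q k = 1) (f : Fin K → ℝ) :
    pairMean q (fun i _ => f i) = ∑ i, q i * f i := by
  unfold pairMean
  refine Finset.sum_congr rfl fun i _ => ?_
  rw [← Finset.sum_mul, ← Finset.mul_sum, hq1, mul_one]

theorem pairMean_right {q : Fin K → ℝ} (hq1 : ∑ k, q k = 1) (f : Fin K → ℝ) :
    pairMean q (fun _ j => f j) = ∑ i, q i * f i := by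
  unfold pairMean
  rw [Finset.sum_comm]
  refine Finset.sum_congr rfl fun i _ => ?_
  rw [← Finset.sum_mul, ← Finset.sum_mul, hq1, one_mul]

theorem pairMean_const {q : Fin K → ℝ} (hq1 : ∑ k, q k = 1) (c : ℝ) :
    pairMean q (fun _ _ => c) = c := by
  rw [pairMean_left hq1 fun _ => c, ← Finset.sum_mul, hq1, one_mul]

/-- The mean of a function of the feedback in a round where both items are drawn from `q`. -/
def roundMean (E : Instance K d) (q : Fin K → ℝ) (G : Feedback K d → ℝ) : ℝ :=
  pairMean q fun i j => ∫ e, G (observe i j e) ∂E.law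

/-- The Lagrangian `2 s(k) + Z λᵀ [(B/T) 1 - 2 v(k)]` that `ℓ̂(k)` estimates without bias. -/
def meanLagrangian (a : Params d) (E : Instance K d) (l : Fin d → ℝ) (k : Fin K) : ℝ :=
  2 * E.fullScore k + a.Z * ∑ r, l r * (a.B / a.T - 2 * E.meanConsumption k r)

theorem Instance.integrable_sum_mul_consumption (E : Instance K d) (c l : Fin d → ℝ) (i : Fin K) :
    Integrable (fun e => ∑ r, l r * (c r - e.2 i r)) E.law := by
  have := E.isProb
  exact integrable_finsetSum _ fun r _ =>
    ((integrable_const _).sub (E.integrable_consumption i r)).const_mul _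

theorem Instance.integral_sum_mul_consumption (E : Instance K d) (c l : Fin d → ℝ) (i : Fin K) :
    ∫ e, ∑ r, l r * (c r - e.2 i r) ∂E.law = ∑ r, l r * (c r - E.meanConsumption i r) := by
  have := E.isProb
  have h : ∀ r ∈ Finset.univ, Integrable (fun e : Outcome K d => l r * (c r - e.2 i r)) E.law :=
    fun r _ => ((integrable_const _).sub (E.integrable_consumption i r)).const_mul _
  rw [integral_finsetSum _ h]
  refine Finset.sum_congr rfl fun r _ => ?_
  rw [integral_const_mul, integral_sub (integrable_const _) (E.integrable_consumption i r)]
  simp [Instance.meanConsumption]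

theorem integrable_lagrangianEst (a : Params d) (E : Instance K d) (q : Fin K → ℝ) (l : Fin d → ℝ)
    (i j k : Fin K) :
    Integrable (fun e => lagrangianEst a q l (observe i j e) k) E.law := by
  have := E.isProb
  simp only [lagrangianEst_observe]
  exact ((((E.integrable_duel i j).div_const _).const_mul _).const_mul _).add
    ((((integrable_const _).add
      ((E.integrable_sum_mul_consumption (fun _ => 1) l i).const_mul _)).add
        ((E.integrable_sum_mul_consumption (fun _ => 1) l j).const_mul _)).const_mul _)

theorem integral_lagrangianEst (a : Params d) (E : Instance K d) (q : Fin K → ℝ) (l : Fin d → ℝ)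
    (i j k : Fin K) :
    ∫ e, lagrangianEst a q l (observe i j e) k ∂E.law =
      2 * (ind i k * (1 / (K * q k) * (E.pref i j / q j))) +
        a.Z * (∑ r, l r * (a.B / a.T - 2) +
          ind i k * (1 / q k * ∑ r, l r * (1 - E.meanConsumption i r)) +
          ind j k * (1 / q k * ∑ r, l r * (1 - E.meanConsumption j r))) := by
  have := E.isProb
  simp only [lagrangianEst_observe]
  have h1 := ((((E.integrable_duel i j).div_const (q j)).const_mul
    (ind i k / (K * q k))).const_mul 2)
  have h2 := (E.integrable_sum_mul_consumption (fun _ => 1) l i).const_mul (ind i k / q k)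
  have h3 := (E.integrable_sum_mul_consumption (fun _ => 1) l j).const_mul (ind j k / q k)
  have h4 : Integrable (fun _ : Outcome K d => ∑ r, l r * (a.B / a.T - 2)) E.law :=
    integrable_const _
  have h5 : Integrable (fun e : Outcome K d => ∑ r, l r * (a.B / a.T - 2) +
      ind i k / q k * ∑ r, l r * (1 - e.2 i r)) E.law := h4.add h2
  have h6 : Integrable (fun e : Outcome K d => a.Z * (∑ r, l r * (a.B / a.T - 2) +
      ind i k / q k * ∑ r, l r * (1 - e.2 i r) +
      ind j k / q k * ∑ r, l r * (1 - e.2 j r))) E.law := (h5.add h3).const_mul _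
  rw [integral_add h1 h6, integral_const_mul, integral_const_mul,
    integral_const_mul, integral_div, E.integral_duel, integral_add h5 h3,
    integral_add h4 h2, integral_const_mul, integral_const_mul,
    E.integral_sum_mul_consumption (fun _ => 1) l i,
    E.integral_sum_mul_consumption (fun _ => 1) l j]
  simp only [integral_const, probReal_univ, one_smul]
  ring

/-- The estimate `ℓ̂` is unbiased. -/
theorem roundMean_lagrangianEst (a : Params d) (E : Instance K d) {q : Fin K → ℝ}
    (hq : ∀ k, 0 < q k) (hq1 : ∑ k, q k = 1) (l : Fin d → ℝ) (k : Fin K) :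
    roundMean E q (fun f => lagrangianEst a q l f k) = meanLagrangian a E l k := by
  simp only [roundMean, integral_lagrangianEst]
  rw [pairMean_add, pairMean_const_mul, pairMean_const_mul, pairMean_add, pairMean_add,
    pairMean_const hq1,
    pairMean_left hq1 fun i => ind i k * (1 / q k * ∑ r, l r * (1 - E.meanConsumption i r)),
    pairMean_right hq1 fun j => ind j k * (1 / q k * ∑ r, l r * (1 - E.meanConsumption j r))]
  have hk := (hq k).ne'
  have h1 : pairMean q (fun i j => ind i k * (1 / (K * q k) * (E.pref i j / q j))) =
      E.fullScore k := by
    calc pairMean q (fun i j => ind i k * (1 / (K * q k) * (E.pref i j / q j)))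
        = ∑ i, ind i k * ∑ j, q i * q j * (1 / (K * q k) * (E.pref i j / q j)) := by
          unfold pairMean
          refine Finset.sum_congr rfl fun i _ => ?_
          rw [Finset.mul_sum]
          refine Finset.sum_congr rfl fun j _ => ?_
          ring
      _ = ∑ j, q k * q j * (1 / (K * q k) * (E.pref k j / q j)) := sum_ind_mul' k _
      _ = E.fullScore k := by
          rw [Instance.fullScore, Finset.sum_div]
          refine Finset.sum_congr rfl fun j _ => ?_
          have := (hq j).ne'
          field_simp
  have h2 : ∑ i, q i * (ind i k * (1 / q k * ∑ r, l r * (1 - E.meanConsumption i r))) =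
      ∑ r, l r * (1 - E.meanConsumption k r) := by
    calc _ = ∑ i, ind i k * (q i * (1 / q k * ∑ r, l r * (1 - E.meanConsumption i r))) :=
          Finset.sum_congr rfl fun i _ => by ring
      _ = q k * (1 / q k * ∑ r, l r * (1 - E.meanConsumption k r)) := sum_ind_mul' k _
      _ = _ := by field_simp
  rw [h1, h2, meanLagrangian, ← Finset.sum_add_distrib, ← Finset.sum_add_distrib]
  congr 2
  refine Finset.sum_congr rfl fun r _ => ?_
  ring

theorem integrable_sum_mul_dualLoss (a : Params d) (E : Instance K d) (l : Fin d → ℝ)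
    (i j : Fin K) : Integrable (fun e => ∑ r, l r * dualLoss a (observe i j e) r) E.law := by
  have := E.isProb
  exact integrable_finsetSum _ fun r _ => ((integrable_const _).sub
    ((E.integrable_consumption i r).add (E.integrable_consumption j r))).const_mul _

theorem roundMean_sum_mul_dualLoss (a : Params d) (E : Instance K d) {q : Fin K → ℝ}
    (hq1 : ∑ k, q k = 1) (l : Fin d → ℝ) :
    roundMean E q (fun f => ∑ r, l r * dualLoss a f r) =
      ∑ k, q k * ∑ r, l r * (a.B / a.T - 2 * E.meanConsumption k r) := by
  have := E.isProb
  have h : ∀ i j, ∫ e, ∑ r, l r * dualLoss a (observe i j e) r ∂E.law =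
      1 / 2 * (∑ r, l r * (a.B / a.T - 2 * E.meanConsumption i r)) +
        1 / 2 * ∑ r, l r * (a.B / a.T - 2 * E.meanConsumption j r) := by
    intro i j
    have e1 : ∀ e : Outcome K d, ∑ r, l r * dualLoss a (observe i j e) r =
        ∑ r, l r * (a.B / a.T - e.2 i r) + ∑ r, l r * (0 - e.2 j r) := by
      intro e
      rw [← Finset.sum_add_distrib]
      refine Finset.sum_congr rfl fun r _ => ?_
      simp only [dualLoss, observe]; ring
    simp only [e1]
    rw [integral_add (E.integrable_sum_mul_consumption (fun _ => a.B / a.T) l i)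
      (E.integrable_sum_mul_consumption (fun _ => 0) l j),
      E.integral_sum_mul_consumption (fun _ => a.B / a.T) l i,
      E.integral_sum_mul_consumption (fun _ => 0) l j, Finset.mul_sum, Finset.mul_sum,
      ← Finset.sum_add_distrib, ← Finset.sum_add_distrib]
    refine Finset.sum_congr rfl fun r _ => ?_
    ring
  simp only [roundMean, h]
  rw [pairMean_add, pairMean_const_mul, pairMean_const_mul,
    pairMean_left hq1 fun i => ∑ r, l r * (a.B / a.T - 2 * E.meanConsumption i r),
    pairMean_right hq1 fun i => ∑ r, l r * (a.B / a.T - 2 * E.meanConsumption i r)]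
  ring

/-- Since `q ≥ γ/K`, the second moment of `ŝ` costs `K/γ` and that of the consumption estimates
`Z² K`. -/
theorem pairMean_squareBound_le (a : Params d) (hK : 0 < K) (hγ : 0 < a.gamma) {q : Fin K → ℝ}
    (hq : ∀ k, a.gamma / K ≤ q k) (hq1 : ∑ k, q k = 1) :
    pairMean q (squareBound a q) ≤ 16 * (K / a.gamma) + 16 * a.Z ^ 2 + 8 * a.Z ^ 2 * K := by
  have hK' : (0 : ℝ) < K := by exact_mod_cast hK
  have hg : 0 < a.gamma / K := by positivity
  have hqp : ∀ k, 0 < q k := fun k => hg.trans_le (hq k)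
  have h1 : pairMean q (fun i j => 1 / ((K : ℝ) ^ 2 * q i * q j ^ 2)) ≤ K / a.gamma := by
    calc pairMean q (fun i j => 1 / ((K : ℝ) ^ 2 * q i * q j ^ 2))
        ≤ ∑ _i : Fin K, ∑ _j : Fin K, 1 / ((K : ℝ) ^ 2 * (a.gamma / K)) := by
          refine Finset.sum_le_sum fun i _ => Finset.sum_le_sum fun j _ => ?_
          have hi := hqp i
          have hj := hqp j
          have e : q i * q j * (1 / ((K : ℝ) ^ 2 * q i * q j ^ 2)) = 1 / ((K : ℝ) ^ 2 * q j) := by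
            field_simp
          rw [e]
          have := hq j
          gcongr
      _ = K / a.gamma := by simp; field_simp
  have h2 : ∑ k, q k * (1 / q k) = (K : ℝ) := by
    have : ∀ k, q k * (1 / q k) = 1 := fun k => by rw [mul_one_div, div_self (hqp k).ne']
    rw [Finset.sum_congr rfl fun k _ => this k]; simp
  unfold squareBound
  rw [pairMean_add, pairMean_add, pairMean_add, pairMean_const_mul, pairMean_const_mul,
    pairMean_const_mul, pairMean_const_mul, pairMean_const hq1, pairMean_left hq1 fun k => 1 / q k,
    pairMean_right hq1 fun k => 1 / q k, h2]
  linarith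

/-- The quantity whose sum over the rounds is bounded on every sample path: the instantaneous regret
of exponential weights against `p` on the estimates (written through the sampling distribution `q`,
which is a mixture with weight `γ`), less its quadratic term, plus `Z` times the loss of the dual
player, plus the scores of the two items. In the mean over a round the estimated Lagrangian of `q`
cancels against the last two terms, and the Lagrangian of `p` remains. -/
def gain (a : Params d) (E : Instance K d) (p q : Fin K → ℝ) (l : Fin d → ℝ)
    (f : Feedback K d) : ℝ :=
  ∑ k, (p k - q k + a.gamma * (1 / K - p k)) * lagrangianEst a q l f k -
    81 * a.eta * squareBound a q f.x f.y + a.Z * ∑ r, l r * dualLoss a f r +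
      (E.fullScore f.x + E.fullScore f.y)

theorem meanLagrangian_mem (a : Params d) (E : Instance K d) (hZ : 0 ≤ a.Z) (hβ0 : 0 ≤ a.B / a.T)
    (hβ : a.B / a.T ≤ 2) {l : Fin d → ℝ} (hl : l ∈ dualSet d) (k : Fin K) :
    2 * E.fullScore k - 2 * a.Z ≤ meanLagrangian a E l k ∧
      meanLagrangian a E l k ≤ 2 * E.fullScore k + 2 * a.Z := by
  have h : |∑ r, l r * (a.B / a.T - 2 * E.meanConsumption k r)| ≤ 2 := by
    refine abs_sum_mul_le_of_mem_dualSet hl zero_le_two fun r => ?_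
    obtain ⟨h0, h1⟩ := E.meanConsumption_mem k r
    rw [abs_le]; constructor <;> linarith
  obtain ⟨h0, h1⟩ := abs_le.1 h
  unfold meanLagrangian
  constructor <;> nlinarith

/-- The error terms of one round: the exploration cost and the quadratic term of exponential
weights, for `η K = γ²`. -/
def roundError (a : Params d) : ℝ :=
  a.gamma * (2 + 4 * a.Z) + 81 * (16 * a.gamma + 24 * (a.gamma * a.Z) ^ 2)

/-- In the mean over a round the sampling distribution cancels out of the gain. -/
theorem le_roundMean_gain (a : Params d) (E : Instance K d) (hK : 0 < K) (hη : 0 ≤ a.eta)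
    (hγ : 0 < a.gamma) (hηγ : a.eta * K = a.gamma ^ 2)
    (hZ : 0 ≤ a.Z) (hβ0 : 0 ≤ a.B / a.T) (hβ : a.B / a.T ≤ 2)
    {p : Fin K → ℝ} (hp : ∀ k, 0 ≤ p k) (hp1 : ∑ k, p k = 1)
    {q : Fin K → ℝ} (hq : ∀ k, a.gamma / K ≤ q k) (hq1 : ∑ k, q k = 1)
    {l : Fin d → ℝ} (hl : l ∈ dualSet d) :
    ∑ k, p k * meanLagrangian a E l k - roundError a ≤ roundMean E q (gain a E p q l) := by
  have := E.isProb
  have hK' : (1 : ℝ) ≤ K := by exact_mod_cast hK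
  have hqp : ∀ k, 0 < q k := fun k => (by positivity : 0 < a.gamma / K).trans_le (hq k)
  have hint : ∀ i j, ∫ e, gain a E p q l (observe i j e) ∂E.law =
      ∑ k, (p k - q k + a.gamma * (1 / K - p k)) *
        (∫ e, lagrangianEst a q l (observe i j e) k ∂E.law) -
      81 * a.eta * squareBound a q i j +
      a.Z * (∫ e, ∑ r, l r * dualLoss a (observe i j e) r ∂E.law) +
      (E.fullScore i + E.fullScore j) := by
    intro i j
    have h1 : Integrable (fun e => ∑ k, (p k - q k + a.gamma * (1 / K - p k)) *
        lagrangianEst a q l (observe i j e) k) E.law :=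
      integrable_finsetSum _ fun k _ => (integrable_lagrangianEst a E q l i j k).const_mul _
    have h2 := (integrable_sum_mul_dualLoss a E l i j).const_mul a.Z
    have c1 : Integrable (fun _ : Outcome K d => 81 * a.eta * squareBound a q i j) E.law :=
      integrable_const _
    have c2 : Integrable (fun _ : Outcome K d => E.fullScore i + E.fullScore j) E.law :=
      integrable_const _
    have h3 : Integrable (fun e => ∑ k, (p k - q k + a.gamma * (1 / K - p k)) *
        lagrangianEst a q l (observe i j e) k - 81 * a.eta * squareBound a q i j) E.law := h1.sub c1
    have h4 : Integrable (fun e => ∑ k, (p k - q k + a.gamma * (1 / K - p k)) *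
        lagrangianEst a q l (observe i j e) k - 81 * a.eta * squareBound a q i j +
        a.Z * ∑ r, l r * dualLoss a (observe i j e) r) E.law := h3.add h2
    change ∫ e, (∑ k, (p k - q k + a.gamma * (1 / K - p k)) *
      lagrangianEst a q l (observe i j e) k - 81 * a.eta * squareBound a q i j +
      a.Z * ∑ r, l r * dualLoss a (observe i j e) r + (E.fullScore i + E.fullScore j)) ∂E.law = _
    rw [integral_add h4 c2, integral_add h3 h2, integral_sub h1 c1,
      integral_const_mul, integral_finsetSum _ fun k _ =>
        (integrable_lagrangianEst a E q l i j k).const_mul _]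
    simp only [integral_const_mul, integral_const, probReal_univ, one_smul]
  have hmean : roundMean E q (gain a E p q l) =
      ∑ k, (p k - q k + a.gamma * (1 / K - p k)) * meanLagrangian a E l k -
      81 * a.eta * pairMean q (squareBound a q) +
      a.Z * (∑ k, q k * ∑ r, l r * (a.B / a.T - 2 * E.meanConsumption k r)) +
      (∑ k, q k * E.fullScore k + ∑ k, q k * E.fullScore k) := by
    simp only [roundMean, hint]
    rw [pairMean_add, pairMean_add, pairMean_sub, pairMean_sum, pairMean_const_mul,
      pairMean_const_mul, pairMean_add, pairMean_left hq1, pairMean_right hq1,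
      ← roundMean_sum_mul_dualLoss a E hq1]
    congr 3
    refine Finset.sum_congr rfl fun k _ => ?_
    rw [pairMean_const_mul, ← roundMean_lagrangianEst a E hqp hq1 l k, roundMean]
  have hcancel : a.Z * (∑ k, q k * ∑ r, l r * (a.B / a.T - 2 * E.meanConsumption k r)) +
      (∑ k, q k * E.fullScore k + ∑ k, q k * E.fullScore k) =
      ∑ k, q k * meanLagrangian a E l k := by
    rw [Finset.mul_sum, ← Finset.sum_add_distrib, ← Finset.sum_add_distrib]
    refine Finset.sum_congr rfl fun k _ => ?_
    unfold meanLagrangian; ring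
  have hexp : ∑ k, (p k - q k + a.gamma * (1 / K - p k)) * meanLagrangian a E l k =
      ∑ k, p k * meanLagrangian a E l k - ∑ k, q k * meanLagrangian a E l k +
        a.gamma * (∑ k, 1 / K * meanLagrangian a E l k -
          ∑ k, p k * meanLagrangian a E l k) := by
    rw [← Finset.sum_sub_distrib, ← Finset.sum_sub_distrib, Finset.mul_sum,
      ← Finset.sum_add_distrib]
    refine Finset.sum_congr rfl fun k _ => ?_
    ring
  have hup : ∑ k, p k * meanLagrangian a E l k ≤ 2 + 2 * a.Z := by
    calc ∑ k, p k * meanLagrangian a E l k ≤ ∑ k, p k * (2 + 2 * a.Z) := by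
          refine Finset.sum_le_sum fun k _ => mul_le_mul_of_nonneg_left ?_ (hp k)
          linarith [(meanLagrangian_mem a E hZ hβ0 hβ hl k).2, E.fullScore_le_one k]
      _ = 2 + 2 * a.Z := by rw [← Finset.sum_mul, hp1, one_mul]
  have hlo : -(2 * a.Z) ≤ ∑ k, 1 / (K : ℝ) * meanLagrangian a E l k := by
    calc -(2 * a.Z) = ∑ _k : Fin K, 1 / (K : ℝ) * (-(2 * a.Z)) := by simp; field_simp
      _ ≤ _ := by
          refine Finset.sum_le_sum fun k _ => mul_le_mul_of_nonneg_left ?_ (by positivity)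
          linarith [(meanLagrangian_mem a E hZ hβ0 hβ hl k).1, E.fullScore_nonneg k]
  have hsq : a.eta * pairMean q (squareBound a q) ≤
      16 * a.gamma + 24 * (a.gamma * a.Z) ^ 2 := by
    have h1 := mul_le_mul_of_nonneg_left (pairMean_squareBound_le a hK hγ hq hq1) hη
    have h2 : a.eta * (K / a.gamma) = a.gamma := by
      rw [← mul_div_assoc, hηγ]; field_simp
    have h3 : a.eta * a.Z ^ 2 ≤ a.eta * K * a.Z ^ 2 := by
      rw [mul_assoc]
      exact mul_le_mul_of_nonneg_left (le_mul_of_one_le_left (sq_nonneg _) hK') hη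
    calc _ ≤ _ := h1
      _ = 16 * (a.eta * (K / a.gamma)) + 16 * (a.eta * a.Z ^ 2) +
          8 * (a.eta * K * a.Z ^ 2) := by ring
      _ ≤ 16 * a.gamma + 16 * (a.eta * K * a.Z ^ 2) + 8 * (a.eta * K * a.Z ^ 2) := by
          rw [h2]; linarith
      _ = _ := by rw [hηγ]; ring
  have hγm := mul_le_mul_of_nonneg_left (sub_le_sub hlo hup) hγ.le
  rw [hmean, add_assoc, hcancel, hexp, roundError]
  linarith

/-! ### The sampling distribution -/

/-- The standing assumptions on the parameters. The last one makes `η ℓ̂` bounded above by `4`. -/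
structure Params.Valid (a : Params d) (K : ℕ) : Prop where
  two_le_K : 2 ≤ K
  T_pos : 0 < a.T
  B_pos : 0 < a.B
  B_le : a.B ≤ 2 * a.T
  Z_pos : 0 < a.Z
  eta_pos : 0 < a.eta
  gamma_pos : 0 < a.gamma
  gamma_lt_one : a.gamma < 1
  eta_mul : a.eta * K = a.gamma ^ 2
  gamma_mul_Z_le_one : a.gamma * a.Z ≤ 1

theorem Params.Valid.K_pos {a : Params d} (ha : a.Valid K) : 0 < K := by linarith [ha.two_le_K]

theorem Params.Valid.ratio_nonneg {a : Params d} (ha : a.Valid K) : 0 ≤ a.B / a.T :=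
  div_nonneg ha.B_pos.le (Nat.cast_nonneg _)

theorem Params.Valid.ratio_le_two {a : Params d} (ha : a.Valid K) : a.B / a.T ≤ 2 := by
  have h : (0 : ℝ) < a.T := by exact_mod_cast ha.T_pos
  rw [div_le_iff₀ h]; exact ha.B_le

theorem Params.Valid.le_sampling {a : Params d} (ha : a.Valid K) (S : Fin K → ℝ) (i : Fin K) :
    a.gamma / K ≤ sampling a S i := by
  have h : 0 ≤ (1 - a.gamma) * expWeights a.eta S i :=
    mul_nonneg (by linarith [ha.gamma_lt_one]) (expWeights_nonneg _ _ _)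
  change a.gamma / K ≤ (1 - a.gamma) * expWeights a.eta S i + a.gamma / K
  linarith

theorem Params.Valid.explore_pos {a : Params d} (ha : a.Valid K) : 0 < a.gamma / K :=
  div_pos ha.gamma_pos (by exact_mod_cast ha.K_pos)

theorem Params.Valid.sampling_pos {a : Params d} (ha : a.Valid K) (S : Fin K → ℝ) (i : Fin K) :
    0 < sampling a S i :=
  ha.explore_pos.trans_le (ha.le_sampling S i)

theorem Params.Valid.sum_sampling {a : Params d} (ha : a.Valid K) (S : Fin K → ℝ) :
    ∑ i, sampling a S i = 1 := by
  have hK : (K : ℝ) ≠ 0 := by exact_mod_cast ha.K_pos.ne'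
  change ∑ i, ((1 - a.gamma) * expWeights a.eta S i + a.gamma / K) = 1
  rw [Finset.sum_add_distrib, ← Finset.mul_sum, sum_expWeights ha.K_pos]
  simp
  field_simp
  ring

theorem Params.Valid.sampling_le_one {a : Params d} (ha : a.Valid K) (S : Fin K → ℝ)
    (i : Fin K) : sampling a S i ≤ 1 := by
  rw [← ha.sum_sampling S]
  exact Finset.single_le_sum (fun j _ => (ha.sampling_pos S j).le) (Finset.mem_univ i)

/-! ### Measurability of the algorithm -/

theorem measurable_items {Ω β : Type*} [MeasurableSpace Ω] [MeasurableSpace β] {x y : Ω → Fin K}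
    (hx : Measurable x) (hy : Measurable y) {b : Ω → β} (hb : Measurable b)
    {G : Fin K → Fin K → β → ℝ} (hG : ∀ i j, Measurable (G i j)) :
    Measurable fun ω => G (x ω) (y ω) (b ω) := by
  have h : Measurable fun p : (Fin K × Fin K) × β => G p.1.1 p.1.2 p.2 :=
    measurable_from_prod_countable_right fun p => hG p.1 p.2
  exact h.comp ((hx.prodMk hy).prodMk hb)

theorem measurable_lagrangianEst (a : Params d) (i j k : Fin K) :
    Measurable fun p : (Fin K → ℝ) × (Fin d → ℝ) × Outcome K d =>
      lagrangianEst a p.1 p.2.1 (observe i j p.2.2) k := by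
  simp only [lagrangianEst_observe]
  have h : Measurable fun p : (Fin K → ℝ) × (Fin d → ℝ) × Outcome K d =>
      ind (p.2.2.1 i j) true := (measurable_ind_duel i j).comp (by fun_prop)
  fun_prop

theorem measurable_sampling (a : Params d) (i : Fin K) :
    Measurable fun S : Fin K → ℝ => sampling a S i := by
  unfold sampling; fun_prop

section Measurability

variable {Ω : Type*} [MeasurableSpace Ω] {x y : ℕ → Ω → Fin K} {z : ℕ → Ω → Outcome K d}

theorem measurable_feedback_ux (s : ℕ) (hx : Measurable (x s)) (hz : Measurable (z s))
    (r : Fin d) : Measurable fun ω => (feedback x y z ω s).ux r :=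
  measurable_items hx hx hz (G := fun i _ e => e.2 i r) fun i _ => by fun_prop

theorem measurable_feedback_uy (s : ℕ) (hy : Measurable (y s)) (hz : Measurable (z s))
    (r : Fin d) : Measurable fun ω => (feedback x y z ω s).uy r :=
  measurable_items hy hy hz (G := fun i _ e => e.2 i r) fun i _ => by fun_prop

theorem measurable_dual (a : Params d) (t : ℕ)
    (h : ∀ s < t, Measurable (x s) ∧ Measurable (y s) ∧ Measurable (z s)) :
    Measurable fun ω => dual a (feedback x y z ω) t := by
  refine (a.oco.measurable_play t).comp ?_
  refine measurable_pi_lambda _ fun s => measurable_pi_lambda _ fun r => ?_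
  obtain ⟨hx, hy, hz⟩ := h s s.2
  exact measurable_const.sub ((measurable_feedback_ux (y := y) s hx hz r).add
    (measurable_feedback_uy (x := x) s hy hz r))

theorem measurable_cumEst (a : Params d) (t : ℕ)
    (h : ∀ s < t, Measurable (x s) ∧ Measurable (y s) ∧ Measurable (z s)) :
    Measurable fun ω => cumEst a (feedback x y z ω) t := by
  induction t with
  | zero => exact measurable_const
  | succ t ih =>
    have h' : ∀ s < t, Measurable (x s) ∧ Measurable (y s) ∧ Measurable (z s) :=
      fun s hs => h s (by omega)
    have hS := ih h'
    obtain ⟨hx, hy, hz⟩ := h t (by omega)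
    refine hS.add (measurable_pi_lambda _ fun k => ?_)
    have hq : Measurable fun ω => sampling a (cumEst a (feedback x y z ω) t) :=
      measurable_pi_lambda _ fun i => (measurable_sampling a i).comp hS
    exact measurable_items hx hy (hq.prodMk ((measurable_dual a t h').prodMk hz))
      (G := fun i j p => lagrangianEst a p.1 p.2.1 (observe i j p.2.2) k)
      fun i j => measurable_lagrangianEst a i j k

theorem measurable_policy (a : Params d) (t : ℕ)
    (h : ∀ s < t, Measurable (x s) ∧ Measurable (y s) ∧ Measurable (z s)) :
    Measurable fun ω => policy a (feedback x y z ω) t :=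
  measurable_pi_lambda _ fun i => (measurable_sampling a i).comp (measurable_cumEst a t h)

open Classical in
/-- The indicator that no budget was exceeded before round `t`, so that round `t` starts with the
budgets intact. Unlike the reward indicator it is determined by the rounds before `t`. -/
def active (B : ℝ) (h : ℕ → Feedback K d) (t : ℕ) : ℝ :=
  if ∀ s < t, WithinBudget B h s then 1 else 0

theorem active_nonneg (B : ℝ) (h : ℕ → Feedback K d) (t : ℕ) : 0 ≤ active B h t := by
  unfold active; split_ifs <;> norm_num

theorem active_le_one (B : ℝ) (h : ℕ → Feedback K d) (t : ℕ) : active B h t ≤ 1 := by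
  unfold active; split_ifs <;> norm_num

theorem measurableSet_withinBudget (B : ℝ) (s : ℕ)
    (h : ∀ s' ≤ s, Measurable (x s') ∧ Measurable (y s') ∧ Measurable (z s')) :
    MeasurableSet {ω | WithinBudget B (feedback x y z ω) s} := by
  unfold WithinBudget
  rw [Set.ofPred_forall]
  refine MeasurableSet.iInter fun r => measurableSet_le ?_ measurable_const
  refine Finset.measurable_sum _ fun s' hs' => ?_
  obtain ⟨hx, hy, hz⟩ := h s' (by simp at hs'; omega)
  exact (measurable_feedback_ux (y := y) s' hx hz r).add
    (measurable_feedback_uy (x := x) s' hy hz r)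

theorem measurable_active (B : ℝ) (t : ℕ)
    (h : ∀ s < t, Measurable (x s) ∧ Measurable (y s) ∧ Measurable (z s)) :
    Measurable fun ω => active B (feedback x y z ω) t := by
  classical
  unfold active
  refine Measurable.ite ?_ measurable_const measurable_const
  simp only [Set.ofPred_forall]
  exact MeasurableSet.iInter fun s => MeasurableSet.iInter fun hs =>
    measurableSet_withinBudget B s fun s' hs' => h s' (by omega)

end Measurability

/-! ### Expectations along a run -/

theorem measurable_past {Ω : Type*} {x y : ℕ → Ω → Fin K} {z : ℕ → Ω → Outcome K d}
    {t s : ℕ} (hs : s < t) :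
    Measurable[past x y z t] (x s) ∧ Measurable[past x y z t] (y s) ∧
      Measurable[past x y z t] (z s) := by
  have h : Measurable[past x y z t] fun ω => (x s ω, y s ω, z s ω) :=
    (measurable_pi_apply (⟨s, hs⟩ : Fin t)).comp
      (comap_measurable fun ω (s : Fin t) => (x s ω, y s ω, z s ω))
  exact ⟨measurable_fst.comp h, (measurable_fst.comp measurable_snd).comp h,
    (measurable_snd.comp measurable_snd).comp h⟩

section Run

variable {Ω : Type*} [MeasurableSpace Ω] {x y : ℕ → Ω → Fin K} {z : ℕ → Ω → Outcome K d}

variable {E : Instance K d} {a : Params d} {μ : Measure Ω}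

theorem IsRun.past_le (hR : IsRun E a μ x y z) (t : ℕ) : past x y z t ≤ ‹MeasurableSpace Ω› :=
  Measurable.comap_le <| measurable_pi_lambda _ fun s =>
    (hR.measurable_x s).prodMk ((hR.measurable_y s).prodMk (hR.measurable_z s))

theorem IsRun.measurable_all (hR : IsRun E a μ x y z) (s : ℕ) :
    Measurable (x s) ∧ Measurable (y s) ∧ Measurable (z s) :=
  ⟨hR.measurable_x s, hR.measurable_y s, hR.measurable_z s⟩

theorem measurableSet_goodOutcomes : MeasurableSet (goodOutcomes K d) := by
  unfold goodOutcomes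
  simp only [Set.ofPred_forall]
  refine MeasurableSet.iInter fun i => MeasurableSet.iInter fun r => ?_
  have h : Measurable fun e : Outcome K d => e.2 i r := by fun_prop
  exact h measurableSet_Icc

/-- The consumptions that occur before the horizon lie in `[0,1]`. Nothing is known about later
outcomes, as a run is constrained only before the horizon. -/
theorem IsRun.ae_good [IsFiniteMeasure μ] (hR : IsRun E a μ x y z) :
    ∀ᵐ ω ∂μ, ∀ t < a.T, z t ω ∈ goodOutcomes K d := by
  have hnull : E.law.real (goodOutcomes K d)ᶜ = 0 := by
    rw [measureReal_def, (mem_ae_iff (s := goodOutcomes K d)).1 E.consumption_mem,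
      ENNReal.toReal_zero]
  rw [ae_all_iff]
  intro t
  by_cases ht : t < a.T
  swap
  · exact ae_of_all _ fun ω h => absurd h ht
  have h : ∀ i j, ∀ᵐ ω ∂μ, ¬ (x t ω = i ∧ y t ω = j ∧ z t ω ∈ (goodOutcomes K d)ᶜ) := by
    intro i j
    have h1 := hR.cond_law t ht Set.univ MeasurableSet.univ i j _ measurableSet_goodOutcomes.compl
    rw [hnull, zero_mul, Set.univ_inter, measureReal_def,
      ENNReal.toReal_eq_zero_iff] at h1
    rw [ae_iff]
    simpa using h1.resolve_right (measure_ne_top _ _)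
  filter_upwards [ae_all_iff.2 fun i => ae_all_iff.2 (h i)] with ω hω _
  by_contra hc
  exact hω (x t ω) (y t ω) ⟨rfl, rfl, hc⟩

/-- The feedback of round `t` is distributed, given the past, as in a round where both items are
drawn from `q_t`. The function `F` may depend on the past. -/
theorem IsRun.integral_feedback [IsProbabilityMeasure μ] (hR : IsRun E a μ x y z)
    (ha : a.Valid K) {t : ℕ} (ht : t < a.T) {F : Ω → Feedback K d → ℝ}
    (hF : ∀ i j, @Measurable _ _ (@Prod.instMeasurableSpace Ω (Outcome K d) (past x y z t) _) _
      fun p : Ω × Outcome K d => F p.1 (observe i j p.2))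
    {C : ℝ} (hC : ∀ ω i j, ∀ e ∈ goodOutcomes K d, |F ω (observe i j e)| ≤ C) :
    Integrable (fun ω => F ω (feedback x y z ω t)) μ ∧
    Integrable (fun ω => roundMean E (policy a (feedback x y z ω) t) (F ω)) μ ∧
    ∫ ω, F ω (feedback x y z ω t) ∂μ =
      ∫ ω, roundMean E (policy a (feedback x y z ω) t) (F ω) ∂μ := by
  classical
  have := E.isProb
  have hle := hR.past_le t
  have hgood : ∀ᵐ e ∂E.law, e ∈ goodOutcomes K d := E.consumption_mem
  set q : Ω → Fin K → ℝ := fun ω => policy a (feedback x y z ω) t with hq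
  have hq0 : ∀ ω i, 0 ≤ q ω i := fun ω i => (ha.sampling_pos _ i).le
  have hq1 : ∀ ω i, q ω i ≤ 1 := fun ω i => ha.sampling_le_one _ i
  have hqm : Measurable[past x y z t] q :=
    @measurable_policy K d Ω (past x y z t) x y z a t fun s hs => measurable_past hs
  have hqi : ∀ i, Measurable[past x y z t] fun ω => q ω i := fun i =>
    (measurable_pi_apply i).comp hqm
  have hF' : ∀ i j, Measurable fun p : Ω × Outcome K d => F p.1 (observe i j p.2) := by
    intro i j
    -- enlarging the first factor from the past to the whole σ-algebra
    have hid : @Measurable (Ω × Outcome K d) (Ω × Outcome K d) _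
        (@Prod.instMeasurableSpace Ω (Outcome K d) (past x y z t) _) fun p => p :=
      (measurable_id'' hle).prodMap measurable_id
    exact (hF i j).comp hid
  have hgz := hR.ae_good
  have hSm : ∀ i j, MeasurableSet {ω | x t ω = i ∧ y t ω = j} := fun i j =>
    (hR.measurable_x t (measurableSet_singleton i)).inter
      (hR.measurable_y t (measurableSet_singleton j))
  have hintP : Integrable (fun ω => F ω (feedback x y z ω t)) μ := by
    refine Integrable.of_bound (C := C) ?_ ?_
    · exact (measurable_items (hR.measurable_x t) (hR.measurable_y t)
        (measurable_id.prodMk (hR.measurable_z t))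
        (G := fun i j (p : Ω × Outcome K d) => F p.1 (observe i j p.2)) hF').aestronglyMeasurable
    · filter_upwards [hgz] with ω hω using hC ω _ _ _ (hω t ht)
  have hIm : ∀ i j, Measurable fun ω => ∫ e, F ω (observe i j e) ∂E.law := fun i j =>
    (StronglyMeasurable.integral_prod_right' (ν := E.law) (hF' i j).stronglyMeasurable).measurable
  have hIb : ∀ i j ω, |∫ e, F ω (observe i j e) ∂E.law| ≤ C := by
    intro i j ω
    have h := norm_integral_le_of_norm_le_const (μ := E.law) (f := fun e => F ω (observe i j e))
      (C := C) (by filter_upwards [hgood] with e he using hC ω i j e he)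
    simpa using h
  have hterm : ∀ i j, Integrable
      (fun ω => q ω i * q ω j * ∫ e, F ω (observe i j e) ∂E.law) μ := by
    intro i j
    refine Integrable.of_bound (C := C) ?_ (ae_of_all _ fun ω => ?_)
    · exact ((((hqi i).mono hle le_rfl).mul ((hqi j).mono hle le_rfl)).mul
        (hIm i j)).aestronglyMeasurable
    · rw [Real.norm_eq_abs, abs_mul, abs_of_nonneg (mul_nonneg (hq0 ω i) (hq0 ω j))]
      exact (mul_le_of_le_one_left (abs_nonneg _)
        (mul_le_one₀ (hq1 ω i) (hq0 ω j) (hq1 ω j))).trans (hIb i j ω)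
  have hkey : ∀ i j, ∫ ω in {ω | x t ω = i ∧ y t ω = j}, F ω (observe i j (z t ω)) ∂μ =
      ∫ ω, q ω i * q ω j * ∫ e, F ω (observe i j e) ∂E.law ∂μ := by
    intro i j
    refine @setIntegral_eq_integral_mul_integral Ω Ω (Outcome K d) _ (past x y z t) _ μ _ E.law _
      id (z t) (measurable_id'' hle) (hR.measurable_z t) _ (fun ω => q ω i * q ω j)
      ((hqi i).mul (hqi j)) (fun ω => mul_nonneg (hq0 ω i) (hq0 ω j))
      (fun ω => mul_le_one₀ (hq1 ω i) (hq0 ω j) (hq1 ω j)) ?_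
      (fun p => F p.1 (observe i j p.2)) (hF i j) C ?_
    · intro H hH A hA
      have h := hR.cond_law t ht H hH i j A hA
      have e : {ω | x t ω = i ∧ y t ω = j ∧ z t ω ∈ A} =
          {ω | x t ω = i ∧ y t ω = j} ∩ z t ⁻¹' A := by
        ext ω; simp [and_assoc]
      rw [e] at h
      exact h
    · filter_upwards [hgood] with e he ω using hC ω i j e he
  refine ⟨hintP, ?_, ?_⟩
  · unfold roundMean pairMean
    exact integrable_finsetSum _ fun i _ => integrable_finsetSum _ fun j _ => hterm i j
  · have hsplit : ∀ ω, F ω (feedback x y z ω t) = ∑ i, ∑ j,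
        {ω | x t ω = i ∧ y t ω = j}.indicator (fun ω => F ω (observe i j (z t ω))) ω := by
      intro ω
      simp only [Set.indicator_apply, Set.mem_ofPred_eq]
      rw [Finset.sum_eq_single (x t ω), Finset.sum_eq_single (y t ω)]
      · simp [feedback]
      · intro j _ hj; simp [hj.symm]
      · simp
      · intro i _ hi; simp [hi.symm]
      · simp
    have hind : ∀ i j, Integrable ({ω | x t ω = i ∧ y t ω = j}.indicator
        (fun ω => F ω (observe i j (z t ω)))) μ := by
      intro i j
      have h : {ω | x t ω = i ∧ y t ω = j}.indicator (fun ω => F ω (observe i j (z t ω))) =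
          {ω | x t ω = i ∧ y t ω = j}.indicator (fun ω => F ω (feedback x y z ω t)) := by
        ext ω
        by_cases hω : ω ∈ {ω | x t ω = i ∧ y t ω = j}
        · rw [Set.indicator_of_mem hω, Set.indicator_of_mem hω]
          simp only [feedback, hω.1, hω.2]
        · rw [Set.indicator_of_notMem hω, Set.indicator_of_notMem hω]
      rw [h]
      exact hintP.indicator (hSm i j)
    simp only [hsplit]
    unfold roundMean pairMean
    rw [integral_finsetSum _ fun i _ => integrable_finsetSum _ fun j _ => hind i j,
      integral_finsetSum _ fun i _ => integrable_finsetSum _ fun j _ => hterm i j]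
    refine Finset.sum_congr rfl fun i _ => ?_
    rw [integral_finsetSum _ fun j _ => hind i j, integral_finsetSum _ fun j _ => hterm i j]
    refine Finset.sum_congr rfl fun j _ => ?_
    rw [integral_indicator (hSm i j), hkey i j]

end Run

/-! ### The bound on a sample path -/

/-- The sum over active rounds is a sum over an initial segment, which is proper only if some budget
has been exceeded at its end. -/
theorem exists_stop_active (B : ℝ) (h : ℕ → Feedback K d) (T : ℕ) :
    ∃ n ≤ T, (n < T → ∃ r, B < ∑ s ∈ Finset.range n, ((h s).ux r + (h s).uy r)) ∧
      ∀ X : ℕ → ℝ, ∑ t ∈ Finset.range T, active B h t * X t = ∑ t ∈ Finset.range n, X t := by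
  classical
  obtain ⟨n, hn, h1, h2, h3, h4⟩ := exists_stop (fun t => ∀ s < t, WithinBudget B h s)
    (by simp) (fun t ht s hs => ht s (by omega)) T
  refine ⟨n, hn, fun hnT => ?_, fun X => ?_⟩
  · have hpos := h3 (by omega)
    have hB : ¬ WithinBudget B h (n - 1) := by
      intro hc
      refine h2 hnT fun s hs => ?_
      rcases Nat.lt_or_ge s (n - 1) with hs' | hs'
      · exact h1 (n - 1) (by omega) s hs'
      · rwa [show s = n - 1 by omega]
    unfold WithinBudget at hB
    push Not at hB
    rwa [Nat.sub_add_cancel hpos] at hB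
  · rw [← h4 X]
    refine Finset.sum_congr rfl fun t _ => ?_
    unfold active
    congr

theorem abs_dualLoss_le {a : Params d} (ha : a.Valid K) (i j : Fin K) {e : Outcome K d}
    (he : e ∈ goodOutcomes K d) (r : Fin d) : |dualLoss a (observe i j e) r| ≤ 2 := by
  have h0 := ha.ratio_nonneg
  have h1 := ha.ratio_le_two
  obtain ⟨u0, u1⟩ := he i r
  obtain ⟨v0, v1⟩ := he j r
  simp only [dualLoss, observe]
  rw [abs_le]; constructor <;> linarith

/-- The dual player competes with the multiplier of a resource that ran out, or with `0` if none
did: either way its total loss is at most its regret less `B (1 - n/T)`. -/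
theorem sum_dual_loss_le {a : Params d} (ha : a.Valid K) {c₀ : ℝ} (hA : a.oco.HasRegret a.T c₀)
    {xs ys : ℕ → Fin K} {zs : ℕ → Outcome K d} (hz : ∀ t < a.T, zs t ∈ goodOutcomes K d)
    {h : ℕ → Feedback K d} (hh : ∀ t, h t = observe (xs t) (ys t) (zs t)) {n : ℕ} (hn : n ≤ a.T)
    (hover : n < a.T → ∃ r, a.B < ∑ s ∈ Finset.range n, ((h s).ux r + (h s).uy r)) :
    ∑ t ∈ Finset.range n, ∑ r, dual a h t r * dualLoss a (h t) r ≤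
      c₀ * √(a.T * Real.log (d + 1)) - a.B * (1 - n / a.T) := by
  have hT : (0 : ℝ) < a.T := by exact_mod_cast ha.T_pos
  -- the losses are set to `0` beyond the horizon, where outcomes need not be bounded
  set c : ℕ → Fin d → ℝ := fun t r => if t < a.T then dualLoss a (h t) r else 0 with hc
  have hcb : ∀ t r, |c t r| ≤ 2 := by
    intro t r
    simp only [hc]
    split_ifs with ht
    · rw [hh]; exact abs_dualLoss_le ha _ _ (hz t ht) r
    · simp
  have hceq : ∀ t < a.T, c t = dualLoss a (h t) := by
    intro t ht; ext r; simp [hc, ht]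
  have hplay : ∀ t < n, ∑ r, a.oco.play t (fun s => c s) r * c t r =
      ∑ r, dual a h t r * dualLoss a (h t) r := by
    intro t ht
    have e : (fun s : Fin t => c s) = fun s : Fin t => dualLoss a (h s) := by
      ext s; rw [hceq s (by omega)]
    rw [e, hceq t (by omega)]; rfl
  have hsum : ∑ t ∈ Finset.range n, ∑ r, a.oco.play t (fun s => c s) r * c t r =
      ∑ t ∈ Finset.range n, ∑ r, dual a h t r * dualLoss a (h t) r :=
    Finset.sum_congr rfl fun t ht => hplay t (Finset.mem_range.1 ht)
  have hreg : ∀ l ∈ dualSet d, _ := fun l hl => hA c hcb n hn l hl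
  rw [hsum] at hreg
  rcases hn.lt_or_eq with hlt | rfl
  · -- resource `r` ran out: compare with its unit multiplier
    obtain ⟨r, hr⟩ := hover hlt
    have hl : (fun k => ind r k) ∈ dualSet d := by
      refine ⟨fun k => ind_nonneg _ _, ?_⟩
      simp [ind]
    have h1 := hreg _ hl
    have e : ∑ t ∈ Finset.range n, ∑ k, ind r k * c t k =
        n * (a.B / a.T) - ∑ s ∈ Finset.range n, ((h s).ux r + (h s).uy r) := by
      rw [show (n : ℝ) * (a.B / a.T) = ∑ _s ∈ Finset.range n, a.B / a.T by simp,
        ← Finset.sum_sub_distrib]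
      refine Finset.sum_congr rfl fun t ht => ?_
      rw [sum_ind_mul, hceq t (by have := Finset.mem_range.1 ht; omega)]
      rfl
    rw [e] at h1
    have e2 : a.B * (1 - n / a.T) = a.B - n * (a.B / a.T) := by field_simp
    linarith
  · -- no budget was exceeded: compare with the dual point `0`
    have h1 := hreg 0 ⟨fun _ => le_rfl, by simp⟩
    simp only [Pi.zero_apply, zero_mul, Finset.sum_const_zero, sub_zero] at h1
    rw [div_self hT.ne']
    linarith

/-- On every sample path the total gain up to the stopping index is controlled by the regret of
exponential weights and the regret of the dual player. -/
theorem sum_gain_le {a : Params d} (ha : a.Valid K) (E : Instance K d) {c₀ : ℝ}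
    (hA : a.oco.HasRegret a.T c₀) {p : Fin K → ℝ} (hp : ∀ k, 0 ≤ p k) (hp1 : ∑ k, p k = 1)
    {xs ys : ℕ → Fin K} {zs : ℕ → Outcome K d} (hz : ∀ t < a.T, zs t ∈ goodOutcomes K d)
    {h : ℕ → Feedback K d} (hh : ∀ t, h t = observe (xs t) (ys t) (zs t)) {n : ℕ} (hn : n ≤ a.T)
    (hover : n < a.T → ∃ r, a.B < ∑ s ∈ Finset.range n, ((h s).ux r + (h s).uy r)) :
    ∑ t ∈ Finset.range n, gain a E p (policy a h t) (dual a h t) (h t) ≤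
      Real.log K / a.eta + a.Z * (c₀ * √(a.T * Real.log (d + 1)) - a.B * (1 - n / a.T)) +
        ∑ t ∈ Finset.range n, (E.fullScore (h t).x + E.fullScore (h t).y) := by
  have hK : (0 : ℝ) < K := by exact_mod_cast ha.K_pos
  have hγ := ha.gamma_pos
  set g : ℕ → Fin K → ℝ := fun t => lagrangianEst a (policy a h t) (dual a h t) (h t) with hg
  have hdual : ∀ t, dual a h t ∈ dualSet d := fun t => a.oco.play_mem _ _
  have hgle : ∀ t < n, ∀ i, a.eta * g t i ≤ 4 := by
    intro t ht i
    have h1 := lagrangianEst_le a ha.Z_pos.le ha.ratio_nonneg ha.ratio_le_two hγ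
      (ha.le_sampling (cumEst a h t)) (hdual t) (xs t) (ys t) (hz t (by omega)) i
    rw [← hh] at h1
    have h2 := mul_le_mul_of_nonneg_left h1 ha.eta_pos.le
    have e : a.eta * (2 * (K / a.gamma ^ 2) + 2 * a.Z * (K / a.gamma)) =
        2 * (a.eta * K) / a.gamma ^ 2 + 2 * a.Z * (a.eta * K) / a.gamma := by ring
    rw [e, ha.eta_mul] at h2
    have e2 : 2 * a.gamma ^ 2 / a.gamma ^ 2 + 2 * a.Z * a.gamma ^ 2 / a.gamma =
        2 + 2 * (a.gamma * a.Z) := by field_simp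
    rw [e2] at h2
    have := ha.gamma_mul_Z_le_one
    exact h2.trans (by linarith)
  have hew := expWeights_regret ha.K_pos ha.eta_pos g (cumEst a h) rfl (fun t => rfl) n hgle p hp hp1
  have h1γ : 0 ≤ 1 - a.gamma := by linarith [ha.gamma_lt_one]
  have hq : ∀ t i, policy a h t i =
      (1 - a.gamma) * expWeights a.eta (cumEst a h t) i + a.gamma / K := fun _ _ => rfl
  have hlin : ∀ t, ∑ k, (p k - policy a h t k + a.gamma * (1 / K - p k)) * g t k =
      (1 - a.gamma) * ∑ k, (p k - expWeights a.eta (cumEst a h t) k) * g t k := by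
    intro t
    rw [Finset.mul_sum]
    refine Finset.sum_congr rfl fun k _ => ?_
    rw [hq]; ring
  have hquad : ∀ t < n, (1 - a.gamma) * ∑ k, expWeights a.eta (cumEst a h t) k * g t k ^ 2 ≤
      squareBound a (policy a h t) (h t).x (h t).y := by
    intro t ht
    have h1 := sum_mul_lagrangianEst_sq_le a ha.ratio_nonneg ha.ratio_le_two
      (ha.sampling_pos (cumEst a h t)) (ha.sum_sampling (cumEst a h t)) (hdual t) (xs t) (ys t)
      (hz t (by omega))
    rw [← hh] at h1
    have h2 : squareBound a (policy a h t) (h t).x (h t).y =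
        squareBound a (policy a h t) (xs t) (ys t) := by rw [hh]; rfl
    rw [h2]
    refine le_trans ?_ h1
    rw [Finset.mul_sum]
    refine Finset.sum_le_sum fun k _ => ?_
    rw [← mul_assoc]
    refine mul_le_mul_of_nonneg_right ?_ (sq_nonneg _)
    change _ ≤ policy a h t k
    rw [hq]
    linarith [ha.explore_pos]
  have hdl := mul_le_mul_of_nonneg_left (sum_dual_loss_le ha hA hz hh hn hover) ha.Z_pos.le
  have hmix := mul_le_mul_of_nonneg_left hew h1γ
  have hlog : (1 - a.gamma) * (Real.log K / a.eta) ≤ Real.log K / a.eta :=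
    mul_le_of_le_one_left (div_nonneg (Real.log_natCast_nonneg _) ha.eta_pos.le) (by linarith)
  have hquad' : (1 - a.gamma) * ∑ t ∈ Finset.range n,
      ∑ k, expWeights a.eta (cumEst a h t) k * g t k ^ 2 ≤
      ∑ t ∈ Finset.range n, squareBound a (policy a h t) (h t).x (h t).y := by
    rw [Finset.mul_sum]
    exact Finset.sum_le_sum fun t ht => hquad t (Finset.mem_range.1 ht)
  have hquad2 := mul_le_mul_of_nonneg_left hquad'
    (by linarith [ha.eta_pos] : 0 ≤ 81 * a.eta)
  have hsplit : ∑ t ∈ Finset.range n, gain a E p (policy a h t) (dual a h t) (h t) =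
      (1 - a.gamma) * (∑ t ∈ Finset.range n,
        ∑ k, (p k - expWeights a.eta (cumEst a h t) k) * g t k) -
      81 * a.eta * (∑ t ∈ Finset.range n, squareBound a (policy a h t) (h t).x (h t).y) +
      a.Z * (∑ t ∈ Finset.range n, ∑ r, dual a h t r * dualLoss a (h t) r) +
      ∑ t ∈ Finset.range n, (E.fullScore (h t).x + E.fullScore (h t).y) := by
    rw [Finset.mul_sum, Finset.mul_sum, Finset.mul_sum, ← Finset.sum_sub_distrib,
      ← Finset.sum_add_distrib, ← Finset.sum_add_distrib]
    refine Finset.sum_congr rfl fun t _ => ?_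
    rw [← hlin]; rfl
  rw [hsplit]
  linarith

theorem measurable_gain (a : Params d) (E : Instance K d) (p : Fin K → ℝ) (i j : Fin K) :
    Measurable fun v : (Fin K → ℝ) × (Fin d → ℝ) × Outcome K d =>
      gain a E p v.1 v.2.1 (observe i j v.2.2) := by
  have h := measurable_lagrangianEst (K := K) a i j
  unfold gain
  simp only [squareBound, dualLoss, observe] at h ⊢
  fun_prop

/-- The gain is bounded, as required for integrability; the bound may depend on all parameters. -/
theorem exists_abs_gain_le {a : Params d} (ha : a.Valid K) (E : Instance K d) {p : Fin K → ℝ}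
    (hp : ∀ k, 0 ≤ p k) (hp1 : ∑ k, p k = 1) :
    ∃ C, ∀ S : Fin K → ℝ, ∀ l ∈ dualSet d, ∀ i j, ∀ e ∈ goodOutcomes K d,
      |gain a E p (sampling a S) l (observe i j e)| ≤ C := by
  have hK : (1 : ℝ) ≤ K := by exact_mod_cast ha.K_pos
  have hg := ha.explore_pos
  have hγ := ha.gamma_pos
  have hγ1 := ha.gamma_lt_one
  set M : ℝ := 16 * (1 / ((K : ℝ) ^ 2 * (a.gamma / K) * (a.gamma / K) ^ 2)) + 16 * a.Z ^ 2 +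
    4 * a.Z ^ 2 * (1 / (a.gamma / K)) + 4 * a.Z ^ 2 * (1 / (a.gamma / K)) with hM
  refine ⟨∑ _k : Fin K, 2 * (1 + M / (a.gamma / K)) + 81 * a.eta * M + a.Z * 2 + 2, ?_⟩
  intro S l hl i j e he
  set q := sampling a S
  have hqp : ∀ k, 0 < q k := ha.sampling_pos S
  have hqle : ∀ k, a.gamma / K ≤ q k := ha.le_sampling S
  have hsb0 : 0 ≤ squareBound a q i j := by
    have := hqp i
    have := hqp j
    unfold squareBound; positivity
  have hsb : squareBound a q i j ≤ M := by
    have := hqle i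
    have := hqle j
    have := hqp i
    have := hqp j
    rw [hM]; unfold squareBound; gcongr
  have hl2 : ∀ k, |lagrangianEst a q l (observe i j e) k| ≤ 1 + M / (a.gamma / K) := by
    intro k
    set X := lagrangianEst a q l (observe i j e) k
    have h1 := sum_mul_lagrangianEst_sq_le a ha.ratio_nonneg ha.ratio_le_two hqp
      (ha.sum_sampling S) hl i j he
    have h2 : q k * X ^ 2 ≤ M := le_trans (Finset.single_le_sum
      (f := fun k => q k * lagrangianEst a q l (observe i j e) k ^ 2)
      (fun k _ => mul_nonneg (hqp k).le (sq_nonneg _)) (Finset.mem_univ k)) (h1.trans hsb)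
    have h3 : X ^ 2 ≤ M / (a.gamma / K) := by
      rw [le_div_iff₀ hg]
      nlinarith [mul_le_mul_of_nonneg_right (hqle k) (sq_nonneg X)]
    nlinarith [sq_nonneg (|X| - 1), sq_abs X, abs_nonneg X]
  have hcoef : ∀ k, |p k - q k + a.gamma * (1 / K - p k)| ≤ 2 := by
    intro k
    have h1 : p k ≤ 1 := by
      rw [← hp1]; exact Finset.single_le_sum (fun j _ => hp j) (Finset.mem_univ k)
    have h2 := hp k
    have h3 := (hqp k).le
    have h4 : q k ≤ 1 := ha.sampling_le_one S k
    have h5 : 1 / (K : ℝ) ≤ 1 := by rw [div_le_one (by linarith)]; exact hK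
    have h6 : 0 ≤ 1 / (K : ℝ) := by positivity
    rw [abs_le]; constructor <;> nlinarith
  have hlag : |∑ k, (p k - q k + a.gamma * (1 / K - p k)) *
      lagrangianEst a q l (observe i j e) k| ≤ ∑ _k : Fin K, 2 * (1 + M / (a.gamma / K)) := by
    refine (Finset.abs_sum_le_sum_abs _ _).trans (Finset.sum_le_sum fun k _ => ?_)
    rw [abs_mul]
    exact mul_le_mul (hcoef k) (hl2 k) (abs_nonneg _) zero_le_two
  have hdl := abs_sum_mul_le_of_mem_dualSet hl zero_le_two (abs_dualLoss_le ha i j he)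
  have hZdl : |a.Z * ∑ r, l r * dualLoss a (observe i j e) r| ≤ a.Z * 2 := by
    rw [abs_mul, abs_of_pos ha.Z_pos]
    exact mul_le_mul_of_nonneg_left hdl ha.Z_pos.le
  have hsq := mul_le_mul_of_nonneg_left hsb (by linarith [ha.eta_pos] : 0 ≤ 81 * a.eta)
  have hsq0 := mul_nonneg (by linarith [ha.eta_pos] : 0 ≤ 81 * a.eta) hsb0
  have s1 := E.fullScore_nonneg i
  have s2 := E.fullScore_nonneg j
  have s3 := E.fullScore_le_one i
  have s4 := E.fullScore_le_one j
  change |∑ k, (p k - q k + a.gamma * (1 / K - p k)) * lagrangianEst a q l (observe i j e) k -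
    81 * a.eta * squareBound a q i j + a.Z * ∑ r, l r * dualLoss a (observe i j e) r +
    (E.fullScore i + E.fullScore j)| ≤ _
  rw [abs_le] at *
  constructor <;> linarith [hlag.1, hlag.2, hZdl.1, hZdl.2]

theorem roundMean_const_mul (E : Instance K d) (q : Fin K → ℝ) (c : ℝ) (G : Feedback K d → ℝ) :
    roundMean E q (fun f => c * G f) = c * roundMean E q G := by
  simp only [roundMean, integral_const_mul, pairMean_const_mul]

/-! ### Rewards and number of rounds of a run -/

/-- Measurability with respect to the product of the past and the new outcome, as required by
`IsRun.integral_feedback`. -/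
theorem measurable_active_fst {Ω : Type*} (B : ℝ) (x y : ℕ → Ω → Fin K)
    (z : ℕ → Ω → Outcome K d) (t : ℕ) :
    @Measurable _ _ (@Prod.instMeasurableSpace Ω (Outcome K d) (past x y z t) inferInstance) _
      fun p : Ω × Outcome K d => active B (feedback x y z p.1) t :=
  (@measurable_active K d Ω (past x y z t) x y z B t fun _ hs => measurable_past hs).comp
    (@measurable_fst Ω (Outcome K d) (past x y z t) inferInstance)

section Run

variable {Ω : Type*} [MeasurableSpace Ω] {x y : ℕ → Ω → Fin K} {z : ℕ → Ω → Outcome K d}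
  {E : Instance K d} {a : Params d} {μ : Measure Ω}

/-- Expected number of rounds that start with the budgets intact. -/
def meanActive (a : Params d) (μ : Measure Ω) (x y : ℕ → Ω → Fin K)
    (z : ℕ → Ω → Outcome K d) : ℝ :=
  ∫ ω, ∑ t ∈ Finset.range a.T, active a.B (feedback x y z ω) t ∂μ

/-- Expected total of `f (x t) + f (y t)` over the rounds that start with the budgets intact. -/
def meanScore (f : Fin K → ℝ) (a : Params d) (μ : Measure Ω) (x y : ℕ → Ω → Fin K)
    (z : ℕ → Ω → Outcome K d) : ℝ :=
  ∫ ω, ∑ t ∈ Finset.range a.T, active a.B (feedback x y z ω) t * (f (x t ω) + f (y t ω)) ∂μ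

theorem IsRun.integrable_active [IsProbabilityMeasure μ] (hR : IsRun E a μ x y z) (B : ℝ) (t : ℕ) :
    Integrable (fun ω => active B (feedback x y z ω) t) μ := by
  refine Integrable.of_bound (C := 1)
    (measurable_active B t fun s _ => hR.measurable_all s).aestronglyMeasurable
    (ae_of_all _ fun ω => ?_)
  rw [Real.norm_of_nonneg (active_nonneg _ _ _)]
  exact active_le_one _ _ _

theorem measurable_score (hR : IsRun E a μ x y z) (f : Fin K → ℝ) (t : ℕ) :
    Measurable fun ω => f (x t ω) + f (y t ω) :=
  ((measurable_of_countable f).comp (hR.measurable_x t)).add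
    ((measurable_of_countable f).comp (hR.measurable_y t))

theorem IsRun.integrable_active_mul_score [IsProbabilityMeasure μ] (hR : IsRun E a μ x y z)
    (B : ℝ) (f : Fin K → ℝ) (t : ℕ) :
    Integrable (fun ω => active B (feedback x y z ω) t * (f (x t ω) + f (y t ω))) μ := by
  refine Integrable.of_bound (C := ∑ i, |f i| + ∑ i, |f i|) ((measurable_active B t fun s _ =>
    hR.measurable_all s).mul (measurable_score hR f t)).aestronglyMeasurable
    (ae_of_all _ fun ω => ?_)
  have h : ∀ i, |f i| ≤ ∑ i, |f i| := fun i =>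
    Finset.single_le_sum (fun j _ => abs_nonneg (f j)) (Finset.mem_univ i)
  rw [Real.norm_eq_abs, abs_mul, abs_of_nonneg (active_nonneg _ _ _)]
  exact (mul_le_of_le_one_left (abs_nonneg _) (active_le_one _ _ _)).trans
    ((abs_add_le _ _).trans (add_le_add (h _) (h _)))

theorem IsRun.integrable_sum_active [IsProbabilityMeasure μ] (hR : IsRun E a μ x y z) :
    Integrable (fun ω => ∑ t ∈ Finset.range a.T, active a.B (feedback x y z ω) t) μ :=
  integrable_finsetSum _ fun t _ => hR.integrable_active a.B t

theorem IsRun.integrable_sum_score [IsProbabilityMeasure μ] (hR : IsRun E a μ x y z)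
    (f : Fin K → ℝ) : Integrable (fun ω => ∑ t ∈ Finset.range a.T,
      active a.B (feedback x y z ω) t * (f (x t ω) + f (y t ω))) μ :=
  integrable_finsetSum _ fun t _ => hR.integrable_active_mul_score a.B f t

theorem IsRun.meanActive_le [IsProbabilityMeasure μ] (hR : IsRun E a μ x y z) :
    meanActive a μ x y z ≤ a.T := by
  have h : meanActive a μ x y z ≤ ∫ _ω, (a.T : ℝ) ∂μ := by
    refine integral_mono hR.integrable_sum_active (integrable_const _) fun ω => ?_
    calc ∑ t ∈ Finset.range a.T, active a.B (feedback x y z ω) t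
        ≤ ∑ _t ∈ Finset.range a.T, (1 : ℝ) := Finset.sum_le_sum fun t _ => active_le_one _ _ _
      _ = a.T := by simp
  simpa using h

/-- A round consumes at most `2` of each resource, so the budget lasts at least `B/2` rounds. -/
theorem IsRun.le_meanActive [IsProbabilityMeasure μ] (hR : IsRun E a μ x y z) (ha : a.Valid K) :
    a.B / 2 ≤ meanActive a μ x y z := by
  have h : ∫ _ω, a.B / 2 ∂μ ≤ meanActive a μ x y z := by
    refine integral_mono_ae (integrable_const _) hR.integrable_sum_active ?_
    filter_upwards [hR.ae_good] with ω hω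
    obtain ⟨n, hn, h1, h2⟩ := exists_stop_active a.B (feedback x y z ω) a.T
    have h3 := h2 fun _ => 1
    simp only [mul_one, Finset.sum_const, Finset.card_range, nsmul_eq_mul] at h3
    change a.B / 2 ≤ ∑ t ∈ Finset.range a.T, active a.B (feedback x y z ω) t
    rw [h3]
    rcases hn.lt_or_eq with hlt | rfl
    · obtain ⟨r, hr⟩ := h1 hlt
      have h4 : ∑ s ∈ Finset.range n,
          ((feedback x y z ω s).ux r + (feedback x y z ω s).uy r) ≤
          ∑ _s ∈ Finset.range n, (2 : ℝ) := by
        refine Finset.sum_le_sum fun s hs => ?_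
        have hg := hω s (by have := Finset.mem_range.1 hs; omega)
        have u1 := (hg (x s ω) r).2
        have u2 := (hg (y s ω) r).2
        simp only [feedback, observe]
        linarith
      simp at h4
      linarith
    · linarith [ha.B_le]
  simpa using h

/-- In a run the full score is an affine rescaling of the Borda score. -/
theorem IsRun.meanScore_fullScore [IsProbabilityMeasure μ] (hR : IsRun E a μ x y z)
    (hK : 2 ≤ K) : meanScore E.fullScore a μ x y z =
      ((K : ℝ) - 1) / K * meanScore E.borda a μ x y z + 1 / K * meanActive a μ x y z := by
  unfold meanScore meanActive
  rw [← integral_const_mul, ← integral_const_mul, ← integral_add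
    ((hR.integrable_sum_score _).const_mul _) (hR.integrable_sum_active.const_mul _)]
  congr 1
  ext ω
  rw [Finset.mul_sum, Finset.mul_sum, ← Finset.sum_add_distrib]
  refine Finset.sum_congr rfl fun t _ => ?_
  rw [E.fullScore_eq hK, E.fullScore_eq hK]
  have : (K : ℝ) ≠ 0 := by positivity
  field_simp
  ring

/-- The round in which a budget is first exceeded is active but earns nothing. It is the only one,
and it is worth at most `2`. -/
theorem IsRun.meanScore_borda_le [IsProbabilityMeasure μ] (hR : IsRun E a μ x y z)
    (hK : 2 ≤ K) : meanScore E.borda a μ x y z - 2 ≤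
      ∫ ω, reward E a.B a.T (feedback x y z ω) ∂μ := by
  classical
  have hm : Measurable fun ω => reward E a.B a.T (feedback x y z ω) := by
    unfold reward
    refine Finset.measurable_sum _ fun t _ => Measurable.ite ?_ ?_ measurable_const
    · exact measurableSet_withinBudget a.B t fun s _ => hR.measurable_all s
    · exact measurable_score hR E.borda t
  have hb : ∀ t ω, 0 ≤ E.borda (x t ω) + E.borda (y t ω) ∧
      E.borda (x t ω) + E.borda (y t ω) ≤ 2 := fun t ω =>
    ⟨add_nonneg (E.borda_nonneg hK _) (E.borda_nonneg hK _),
      by linarith [E.borda_le_one hK (x t ω), E.borda_le_one hK (y t ω)]⟩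
  have hint : Integrable (fun ω => reward E a.B a.T (feedback x y z ω)) μ := by
    refine Integrable.of_bound (C := ∑ _t ∈ Finset.range a.T, (2 : ℝ)) hm.aestronglyMeasurable
      (ae_of_all _ fun ω => (norm_sum_le _ _).trans (Finset.sum_le_sum fun t _ => ?_))
    split_ifs
    · exact (Real.norm_of_nonneg (hb t ω).1).trans_le (hb t ω).2
    · simp
  have h : ∫ ω, (∑ t ∈ Finset.range a.T, active a.B (feedback x y z ω) t *
      (E.borda (x t ω) + E.borda (y t ω)) - 2) ∂μ ≤
      ∫ ω, reward E a.B a.T (feedback x y z ω) ∂μ := by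
    refine integral_mono ((hR.integrable_sum_score _).sub (integrable_const _)) hint fun ω => ?_
    have hstep : ∀ t, active a.B (feedback x y z ω) t * (E.borda (x t ω) + E.borda (y t ω)) -
        2 * (active a.B (feedback x y z ω) t - active a.B (feedback x y z ω) (t + 1)) ≤
        if WithinBudget a.B (feedback x y z ω) t then
          E.borda (x t ω) + E.borda (y t ω) else 0 := by
      intro t
      obtain ⟨h0, h2⟩ := hb t ω
      by_cases h1 : ∀ s < t, WithinBudget a.B (feedback x y z ω) s
      · by_cases h3 : WithinBudget a.B (feedback x y z ω) t
        · have h4 : ∀ s < t + 1, WithinBudget a.B (feedback x y z ω) s := by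
            intro s hs
            rcases Nat.lt_succ_iff_lt_or_eq.1 hs with h | rfl
            · exact h1 s h
            · exact h3
          simp only [active, if_pos h1, if_pos h3, if_pos h4]
          linarith
        · have h4 : ¬ ∀ s < t + 1, WithinBudget a.B (feedback x y z ω) s :=
            fun h => h3 (h t (by omega))
          simp only [active, if_pos h1, if_neg h3, if_neg h4]
          linarith
      · have h4 : ¬ ∀ s < t + 1, WithinBudget a.B (feedback x y z ω) s :=
          fun h => h1 fun s hs => h s (by omega)
        simp only [active, if_neg h1, if_neg h4]
        split_ifs <;> linarith
    have hsum := Finset.sum_le_sum fun t (_ : t ∈ Finset.range a.T) => hstep t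
    rw [Finset.sum_sub_distrib, ← Finset.mul_sum, Finset.sum_range_sub'] at hsum
    have h1 := active_le_one a.B (feedback x y z ω) 0
    have h2 := active_nonneg a.B (feedback x y z ω) a.T
    change ∑ t ∈ Finset.range a.T, active a.B (feedback x y z ω) t *
      (E.borda (x t ω) + E.borda (y t ω)) - 2 ≤ reward E a.B a.T (feedback x y z ω)
    have e : reward E a.B a.T (feedback x y z ω) = ∑ t ∈ Finset.range a.T,
        if WithinBudget a.B (feedback x y z ω) t then
          E.borda (x t ω) + E.borda (y t ω) else 0 := rfl
    rw [e]
    linarith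
  rw [integral_sub (hR.integrable_sum_score _) (integrable_const _)] at h
  simpa [meanScore] using h

/-- The uniform exploration alone earns `γ` per active round, as the Borda scores average to
`1/2`. -/
theorem IsRun.gamma_mul_meanActive_le [IsProbabilityMeasure μ] (hR : IsRun E a μ x y z)
    (ha : a.Valid K) : a.gamma * meanActive a μ x y z ≤ meanScore E.borda a μ x y z := by
  have := E.isProb
  have hK : (0 : ℝ) < K := by exact_mod_cast ha.K_pos
  have hkey : ∀ t < a.T, a.gamma * ∫ ω, active a.B (feedback x y z ω) t ∂μ ≤
      ∫ ω, active a.B (feedback x y z ω) t * (E.borda (x t ω) + E.borda (y t ω)) ∂μ := by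
    intro t ht
    have hF := hR.integral_feedback ha ht
      (F := fun ω f => active a.B (feedback x y z ω) t * (E.borda f.x + E.borda f.y)) (C := 2)
      (fun i j => (measurable_active_fst a.B x y z t).mul_const (E.borda i + E.borda j)) (fun ω i j e _ => by
        have h1 := active_nonneg a.B (feedback x y z ω) t
        have h2 := active_le_one a.B (feedback x y z ω) t
        have h3 := E.borda_nonneg ha.two_le_K i
        have h4 := E.borda_nonneg ha.two_le_K j
        have h5 := E.borda_le_one ha.two_le_K i
        have h6 := E.borda_le_one ha.two_le_K j
        simp only [observe]
        rw [abs_of_nonneg (by positivity)]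
        nlinarith)
    have e : ∫ ω, active a.B (feedback x y z ω) t * (E.borda (x t ω) + E.borda (y t ω)) ∂μ = _ :=
      hF.2.2
    rw [e, ← integral_const_mul]
    refine integral_mono ((hR.integrable_active a.B t).const_mul _) hF.2.1 fun ω => ?_
    change a.gamma * active a.B (feedback x y z ω) t ≤
      roundMean E (policy a (feedback x y z ω) t) _
    rw [roundMean_const_mul, mul_comm]
    refine mul_le_mul_of_nonneg_left ?_ (active_nonneg _ _ _)
    set q := policy a (feedback x y z ω) t
    have hq1 : ∑ k, q k = 1 := ha.sum_sampling _
    have h1 : roundMean E q (fun f => E.borda f.x + E.borda f.y) =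
        ∑ i, q i * E.borda i + ∑ i, q i * E.borda i := by
      simp only [roundMean, observe, integral_const, probReal_univ, one_smul]
      rw [pairMean_add, pairMean_left hq1, pairMean_right hq1]
    have h2 : a.gamma / 2 ≤ ∑ i, q i * E.borda i := by
      calc a.gamma / 2 = ∑ i, a.gamma / K * E.borda i := by
            rw [← Finset.mul_sum, E.sum_borda ha.two_le_K]; field_simp
        _ ≤ _ := Finset.sum_le_sum fun i _ =>
            mul_le_mul_of_nonneg_right (ha.le_sampling _ i) (E.borda_nonneg ha.two_le_K i)
    rw [h1]; linarith
  unfold meanActive meanScore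
  rw [integral_finsetSum _ fun t _ => hR.integrable_active a.B t,
    integral_finsetSum _ fun t _ => hR.integrable_active_mul_score a.B _ t, Finset.mul_sum]
  exact Finset.sum_le_sum fun t ht => hkey t (Finset.mem_range.1 ht)

end Run

/-! ### The primal-dual inequality -/

section Run

variable {Ω : Type*} [MeasurableSpace Ω] {x y : ℕ → Ω → Fin K} {z : ℕ → Ω → Outcome K d}
  {E : Instance K d} {a : Params d} {μ : Measure Ω}

/-- The gain of round `t` on feedback `f`, counted if the round starts with the budgets intact. -/
def activeGain (a : Params d) (E : Instance K d) (p : Fin K → ℝ) (h : ℕ → Feedback K d) (t : ℕ)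
    (f : Feedback K d) : ℝ :=
  active a.B h t * gain a E p (policy a h t) (dual a h t) f

theorem measurable_mul_gain {X : Type*} [MeasurableSpace X] (a : Params d) (E : Instance K d)
    (p : Fin K → ℝ) {c : X → ℝ} (hc : Measurable c) {q : X → Fin K → ℝ} (hq : Measurable q)
    {l : X → Fin d → ℝ} (hl : Measurable l) (i j : Fin K) :
    Measurable fun v : X × Outcome K d =>
      c v.1 * gain a E p (q v.1) (l v.1) (observe i j v.2) := by
  have h1 : Measurable fun v : X × Outcome K d => (q v.1, l v.1, v.2) :=
    (hq.comp measurable_fst).prodMk ((hl.comp measurable_fst).prodMk measurable_snd)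
  have h2 := (measurable_gain a E p i j).comp h1
  have h3 : Measurable fun v : X × Outcome K d => c v.1 := hc.comp measurable_fst
  simp only [Function.comp_def] at h2
  exact h3.mul h2

theorem measurable_activeGain_fst {Ω : Type*} (a : Params d) (E : Instance K d) (p : Fin K → ℝ)
    (x y : ℕ → Ω → Fin K) (z : ℕ → Ω → Outcome K d) (t : ℕ) (i j : Fin K) :
    @Measurable _ _ (@Prod.instMeasurableSpace Ω (Outcome K d) (past x y z t) inferInstance) _
      fun v : Ω × Outcome K d => activeGain a E p (feedback x y z v.1) t (observe i j v.2) :=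
  @measurable_mul_gain K d Ω (past x y z t) a E p _
    (@measurable_active K d Ω (past x y z t) x y z a.B t fun _ hs => measurable_past hs) _
    (@measurable_policy K d Ω (past x y z t) x y z a t fun _ hs => measurable_past hs) _
    (@measurable_dual K d Ω (past x y z t) x y z a t fun _ hs => measurable_past hs) i j

theorem dual_mem (a : Params d) (h : ℕ → Feedback K d) (t : ℕ) : dual a h t ∈ dualSet d :=
  a.oco.play_mem _ _

theorem IsRun.integral_activeGain [IsProbabilityMeasure μ] (hR : IsRun E a μ x y z)
    (ha : a.Valid K) {p : Fin K → ℝ} (hp : ∀ k, 0 ≤ p k) (hp1 : ∑ k, p k = 1) {t : ℕ}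
    (ht : t < a.T) :
    Integrable (fun ω => activeGain a E p (feedback x y z ω) t (feedback x y z ω t)) μ ∧
    Integrable (fun ω => roundMean E (policy a (feedback x y z ω) t)
      (activeGain a E p (feedback x y z ω) t)) μ ∧
    ∫ ω, activeGain a E p (feedback x y z ω) t (feedback x y z ω t) ∂μ =
      ∫ ω, roundMean E (policy a (feedback x y z ω) t)
        (activeGain a E p (feedback x y z ω) t) ∂μ := by
  obtain ⟨C, hC⟩ := exists_abs_gain_le ha E hp hp1
  refine hR.integral_feedback ha ht (F := fun ω => activeGain a E p (feedback x y z ω) t) (C := C)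
    (measurable_activeGain_fst a E p x y z t) fun ω i j e he => ?_
  have h := hC (cumEst a (feedback x y z ω) t) _ (dual_mem a (feedback x y z ω) t) i j e he
  unfold activeGain
  rw [abs_mul, abs_of_nonneg (active_nonneg _ _ _)]
  exact (mul_le_of_le_one_left (abs_nonneg _) (active_le_one _ _ _)).trans h

theorem IsRun.le_integral_sum_activeGain [IsProbabilityMeasure μ] (hR : IsRun E a μ x y z)
    (ha : a.Valid K) {p : Fin K → ℝ} (hp : ∀ k, 0 ≤ p k) (hp1 : ∑ k, p k = 1) {m : ℝ}
    (hm : ∀ l ∈ dualSet d, m ≤ ∑ k, p k * meanLagrangian a E l k) :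
    (m - roundError a) * meanActive a μ x y z ≤
      ∫ ω, ∑ t ∈ Finset.range a.T,
        activeGain a E p (feedback x y z ω) t (feedback x y z ω t) ∂μ := by
  unfold meanActive
  rw [integral_finsetSum _ fun t _ => hR.integrable_active a.B t,
    integral_finsetSum _ fun t ht =>
      (hR.integral_activeGain ha hp hp1 (Finset.mem_range.1 ht)).1, Finset.mul_sum]
  refine Finset.sum_le_sum fun t ht => ?_
  obtain ⟨-, h2, h3⟩ := hR.integral_activeGain ha hp hp1 (Finset.mem_range.1 ht)
  rw [h3, ← integral_const_mul]
  refine integral_mono ((hR.integrable_active a.B t).const_mul _) h2 fun ω => ?_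
  have h4 := le_roundMean_gain a E ha.K_pos ha.eta_pos.le ha.gamma_pos ha.eta_mul ha.Z_pos.le
    ha.ratio_nonneg ha.ratio_le_two hp hp1 (ha.le_sampling (cumEst a (feedback x y z ω) t))
    (ha.sum_sampling _) (dual_mem a (feedback x y z ω) t)
  have h5 := hm _ (dual_mem a (feedback x y z ω) t)
  have h6 : roundMean E (policy a (feedback x y z ω) t) (activeGain a E p (feedback x y z ω) t) =
      active a.B (feedback x y z ω) t * roundMean E (policy a (feedback x y z ω) t)
        (gain a E p (policy a (feedback x y z ω) t) (dual a (feedback x y z ω) t)) :=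
    roundMean_const_mul _ _ _ _
  change (m - roundError a) * active a.B (feedback x y z ω) t ≤ roundMean E
    (policy a (feedback x y z ω) t) (activeGain a E p (feedback x y z ω) t)
  rw [h6, mul_comm]
  exact mul_le_mul_of_nonneg_left (le_trans (by linarith) h4) (active_nonneg _ _ _)

theorem IsRun.ae_sum_activeGain_le [IsProbabilityMeasure μ] (hR : IsRun E a μ x y z)
    (ha : a.Valid K) {c₀ : ℝ} (hA : a.oco.HasRegret a.T c₀) {p : Fin K → ℝ} (hp : ∀ k, 0 ≤ p k)
    (hp1 : ∑ k, p k = 1) :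
    ∀ᵐ ω ∂μ, ∑ t ∈ Finset.range a.T,
        activeGain a E p (feedback x y z ω) t (feedback x y z ω t) ≤
      (Real.log K / a.eta + a.Z * (c₀ * √(a.T * Real.log (d + 1)) - a.B)) +
        a.Z * a.B / a.T * (∑ t ∈ Finset.range a.T, active a.B (feedback x y z ω) t) +
        ∑ t ∈ Finset.range a.T, active a.B (feedback x y z ω) t *
          (E.fullScore (x t ω) + E.fullScore (y t ω)) := by
  filter_upwards [hR.ae_good] with ω hω
  obtain ⟨n, hn, h1, h2⟩ := exists_stop_active a.B (feedback x y z ω) a.T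
  have h3 := sum_gain_le ha E hA hp hp1 (xs := fun t => x t ω) (ys := fun t => y t ω)
    (zs := fun t => z t ω) hω (h := feedback x y z ω) (fun t => rfl) hn h1
  have h4 := h2 fun _ => 1
  simp only [mul_one, Finset.sum_const, Finset.card_range, nsmul_eq_mul] at h4
  have h5 := h2 fun t => E.fullScore (x t ω) + E.fullScore (y t ω)
  have h6 := h2 fun t => gain a E p (policy a (feedback x y z ω) t) (dual a (feedback x y z ω) t)
    (feedback x y z ω t)
  unfold activeGain
  rw [h6, h4, h5]
  refine h3.trans (le_of_eq ?_)
  have h7 : ∑ t ∈ Finset.range n,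
      (E.fullScore (feedback x y z ω t).x + E.fullScore (feedback x y z ω t).y) =
      ∑ t ∈ Finset.range n, (E.fullScore (x t ω) + E.fullScore (y t ω)) := rfl
  rw [h7]
  ring

/-- The primal-dual inequality: `m` is any lower bound for the Lagrangian of the comparator `p` that
is uniform in the dual variable. -/
theorem IsRun.le_meanScore [IsProbabilityMeasure μ] (hR : IsRun E a μ x y z) (ha : a.Valid K)
    {c₀ : ℝ} (hA : a.oco.HasRegret a.T c₀) {p : Fin K → ℝ} (hp : ∀ k, 0 ≤ p k)
    (hp1 : ∑ k, p k = 1) {m : ℝ} (hm : ∀ l ∈ dualSet d, m ≤ ∑ k, p k * meanLagrangian a E l k) :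
    (m - roundError a) * meanActive a μ x y z - Real.log K / a.eta +
        a.Z * a.B * (1 - meanActive a μ x y z / a.T) -
        a.Z * (c₀ * √(a.T * Real.log (d + 1))) ≤
      meanScore E.fullScore a μ x y z := by
  have hlow := hR.le_integral_sum_activeGain ha hp hp1 hm
  set R := c₀ * √(a.T * Real.log (d + 1)) with hRdef
  have i0 : Integrable (fun ω => a.Z * a.B / a.T *
      (∑ t ∈ Finset.range a.T, active a.B (feedback x y z ω) t)) μ :=
    hR.integrable_sum_active.const_mul _
  have i1 : Integrable (fun ω => (Real.log K / a.eta + a.Z * (R - a.B)) +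
      a.Z * a.B / a.T * (∑ t ∈ Finset.range a.T, active a.B (feedback x y z ω) t)) μ :=
    (integrable_const _).add i0
  have hup := integral_mono_ae
    (integrable_finsetSum _ fun t ht =>
      (hR.integral_activeGain ha hp hp1 (Finset.mem_range.1 ht)).1)
    (i1.add (hR.integrable_sum_score E.fullScore)) (hR.ae_sum_activeGain_le ha hA hp hp1)
  have e := integral_add i1 (hR.integrable_sum_score E.fullScore)
  rw [integral_add (integrable_const _) i0, integral_const_mul, integral_const,
    probReal_univ, one_smul] at e
  have h := (hlow.trans hup).trans_eq e
  have e2 : a.Z * a.B * (1 - meanActive a μ x y z / a.T) =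
      a.Z * a.B - a.Z * a.B / a.T * meanActive a μ x y z := by ring
  rw [e2]
  unfold meanScore
  unfold meanActive at h ⊢
  linarith

end Run

/-! ### The benchmark -/

theorem Instance.le_opt (E : Instance K d) (hK : 2 ≤ K) {B : ℝ} {T : ℕ} {p : Fin K → ℝ}
    (hp : p ∈ E.feasible B T) : T * (∑ i, E.borda i * p i + ∑ i, E.borda i * p i) ≤ E.opt B T := by
  refine mul_le_mul_of_nonneg_left (le_csSup ⟨2, ?_⟩ ⟨p, hp, rfl⟩) (Nat.cast_nonneg _)
  rintro _ ⟨q, ⟨hq0, hq1, -⟩, rfl⟩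
  have h : ∑ i, E.borda i * q i ≤ ∑ i, q i := Finset.sum_le_sum fun i _ =>
    mul_le_of_le_one_left (hq0 i) (E.borda_le_one hK i)
  change ∑ i, E.borda i * q i + ∑ i, E.borda i * q i ≤ 2
  linarith

theorem Instance.opt_le (E : Instance K d) {B : ℝ} {T : ℕ} (hT : 0 < T)
    (hne : (E.feasible B T).Nonempty) {M : ℝ}
    (h : ∀ p ∈ E.feasible B T, T * (∑ i, E.borda i * p i + ∑ i, E.borda i * p i) ≤ M) :
    E.opt B T ≤ M := by
  have hT' : (0 : ℝ) < T := by exact_mod_cast hT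
  unfold Instance.opt
  rw [mul_comm, ← le_div_iff₀ hT']
  refine csSup_le (hne.image _) ?_
  rintro _ ⟨p, hp, rfl⟩
  rw [le_div_iff₀ hT', mul_comm]
  exact h p hp

theorem Instance.opt_le_two_mul (E : Instance K d) (hK : 2 ≤ K) {B : ℝ} {T : ℕ} (hT : 0 < T)
    (hne : (E.feasible B T).Nonempty) : E.opt B T ≤ 2 * T := by
  refine E.opt_le hT hne fun p hp => ?_
  have h : ∑ i, E.borda i * p i ≤ ∑ i, p i := Finset.sum_le_sum fun i _ =>
    mul_le_of_le_one_left (hp.1 i) (E.borda_le_one hK i)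
  rw [hp.2.1] at h
  have hT' : (0 : ℝ) < T := by exact_mod_cast hT
  nlinarith

/-! ### Regret in terms of the parameters -/

section Run

variable {Ω : Type*} [MeasurableSpace Ω] {x y : ℕ → Ω → Fin K} {z : ℕ → Ω → Outcome K d}
  {E : Instance K d} {a : Params d} {μ : Measure Ω}

theorem regret_le_opt (E : Instance K d) (hK : 2 ≤ K) (a : Params d) (μ : Measure Ω)
    (x y : ℕ → Ω → Fin K) (z : ℕ → Ω → Outcome K d) :
    regret E a μ x y z ≤ E.opt a.B a.T := by
  refine sub_le_self _ (integral_nonneg fun ω => Finset.sum_nonneg fun t _ => ?_)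
  split_ifs
  · exact add_nonneg (E.borda_nonneg hK _) (E.borda_nonneg hK _)
  · exact le_rfl

/-- For a feasible comparator the constraint part of the Lagrangian is nonnegative, so its value is
a lower bound. While the budget lasts the run keeps up with the comparator; the rounds lost after a
budget is exceeded are paid for by the dual player, as `Z B ≥ OPT`. -/
theorem IsRun.regret_le [IsProbabilityMeasure μ] (hR : IsRun E a μ x y z) (ha : a.Valid K)
    {c₀ : ℝ} (hc₀ : 0 ≤ c₀) (hA : a.oco.HasRegret a.T c₀) (hne : (E.feasible a.B a.T).Nonempty)
    (hZ : E.opt a.B a.T ≤ a.Z * a.B) :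
    regret E a μ x y z ≤ 2 + 2 * (roundError a * a.T + Real.log K / a.eta +
      a.Z * (c₀ * √(a.T * Real.log (d + 1)))) := by
  have hK : (2 : ℝ) ≤ K := by exact_mod_cast ha.two_le_K
  have hT : (0 : ℝ) < a.T := by exact_mod_cast ha.T_pos
  have hγ := ha.gamma_pos
  have hZ0 := ha.Z_pos
  have hη := ha.eta_pos
  have herr : 0 ≤ roundError a := by unfold roundError; positivity
  have hlogK : 0 ≤ Real.log K / a.eta := div_nonneg (Real.log_natCast_nonneg _) hη.le
  have hocc : 0 ≤ a.Z * (c₀ * √(a.T * Real.log (d + 1))) := by positivity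
  have hrew := hR.meanScore_borda_le ha.two_le_K
  have hN := hR.meanActive_le
  have hfull := hR.meanScore_fullScore ha.two_le_K
  set N := meanActive a μ x y z
  set V := meanScore E.borda a μ x y z
  set Q := roundError a * a.T + Real.log K / a.eta + a.Z * (c₀ * √(a.T * Real.log (d + 1))) with hQ
  have hQ0 : 0 ≤ Q := by positivity
  have hopt : E.opt a.B a.T ≤ V + 2 * Q := by
    refine E.opt_le ha.T_pos hne fun p hp => ?_
    have hle := E.le_opt ha.two_le_K hp
    obtain ⟨hp0, hp1, hpv⟩ := hp
    set w := ∑ i, E.borda i * p i + ∑ i, E.borda i * p i with hw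
    -- `k1` is the slope of the full score as a function of the Borda score
    set k1 := ((K : ℝ) - 1) / K with hk1
    have hk1' : 1 / 2 ≤ k1 := by rw [hk1, div_le_div_iff₀ two_pos (by linarith)]; linarith
    have hk1'' : k1 ≤ 1 := by rw [hk1, div_le_one (by linarith)]; linarith
    have hw0 : 0 ≤ w := by
      have : 0 ≤ ∑ i, E.borda i * p i :=
        Finset.sum_nonneg fun i _ => mul_nonneg (E.borda_nonneg ha.two_le_K i) (hp0 i)
      linarith
    have hm : ∀ l ∈ dualSet d, k1 * w + 1 / K ≤ ∑ k, p k * meanLagrangian a E l k := by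
      intro l hl
      have e : ∑ k, p k * meanLagrangian a E l k = k1 * w + 1 / K +
          a.Z * ∑ r, l r * (a.B / a.T -
            (∑ i, E.meanConsumption i r * p i + ∑ i, E.meanConsumption i r * p i)) := by
        have e1 : k1 * w + 1 / K = ∑ k, p k * (2 * E.fullScore k) := by
          have e2 : ∀ k, p k * (2 * E.fullScore k) =
              k1 * (E.borda k * p k + E.borda k * p k) + 1 / K * p k := by
            intro k
            rw [E.fullScore_eq ha.two_le_K, hk1]
            field_simp
            ring
          simp only [e2]
          rw [Finset.sum_add_distrib, ← Finset.mul_sum, ← Finset.mul_sum, hp1,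
            Finset.sum_add_distrib, mul_one]
        have e3 : ∑ r, l r * (a.B / a.T -
            (∑ i, E.meanConsumption i r * p i + ∑ i, E.meanConsumption i r * p i)) =
            ∑ k, p k * ∑ r, l r * (a.B / a.T - 2 * E.meanConsumption k r) := by
          simp only [Finset.mul_sum]
          rw [Finset.sum_comm]
          refine Finset.sum_congr rfl fun r _ => ?_
          have e4 : a.B / a.T = ∑ k, p k * (a.B / a.T) := by rw [← Finset.sum_mul, hp1, one_mul]
          rw [← Finset.sum_add_distrib]
          nth_rewrite 1 [e4]
          rw [← Finset.sum_sub_distrib, Finset.mul_sum]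
          refine Finset.sum_congr rfl fun k _ => ?_
          ring
        rw [e1, e3, Finset.mul_sum, ← Finset.sum_add_distrib]
        refine Finset.sum_congr rfl fun k _ => ?_
        unfold meanLagrangian; ring
      rw [e]
      have : 0 ≤ ∑ r, l r * (a.B / a.T -
          (∑ i, E.meanConsumption i r * p i + ∑ i, E.meanConsumption i r * p i)) :=
        Finset.sum_nonneg fun r _ => mul_nonneg (hl.1 r) (by linarith [hpv r])
      linarith [mul_nonneg hZ0.le this]
    have hmain := hR.le_meanScore ha hA hp0 hp1 hm
    rw [hfull] at hmain
    have h1 : roundError a * N ≤ roundError a * a.T := mul_le_mul_of_nonneg_left hN herr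
    have h2 : k1 * (a.T * w) * (1 - N / a.T) ≤ a.Z * a.B * (1 - N / a.T) := by
      refine mul_le_mul_of_nonneg_right ?_ (by
        rw [sub_nonneg, div_le_one hT]; exact hN)
      have : k1 * (a.T * w) ≤ a.T * w := mul_le_of_le_one_left (by positivity) hk1''
      linarith
    have h3 : k1 * (a.T * w) * (1 - N / a.T) = k1 * (a.T * w) - k1 * w * N := by
      field_simp
    have h4 : k1 * (a.T * w) - k1 * V ≤ Q := by
      rw [hQ]; linarith
    have h5 : k1 * (a.T * w - V) ≤ Q := by linarith
    by_contra! hc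
    nlinarith
  unfold regret
  linarith

/-- When `Z` is below a constant the constraints cannot outweigh the rewards: even if they are
ignored, an item of Borda score at least `1/2`, or the exploration if `γ` is not small, earns a
constant fraction of `B ≥ OPT / Z` until the budget runs out. -/
theorem IsRun.regret_le_of_Z_small [IsProbabilityMeasure μ] (hR : IsRun E a μ x y z)
    (ha : a.Valid K) {c₀ : ℝ} (hc₀ : 0 ≤ c₀) (hA : a.oco.HasRegret a.T c₀)
    (hZ : E.opt a.B a.T ≤ a.Z * a.B) (hsmall : a.Z ≤ 1 / 250000) :
    regret E a μ x y z ≤ 2 + (Real.log K / a.eta +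
      a.Z * (c₀ * √(a.T * Real.log (d + 1)))) := by
  have hK : (2 : ℝ) ≤ K := by exact_mod_cast ha.two_le_K
  have hT : (0 : ℝ) < a.T := by exact_mod_cast ha.T_pos
  have hγ := ha.gamma_pos
  have hZ0 := ha.Z_pos
  have hB := ha.B_pos
  have hη := ha.eta_pos
  have hlogK : 0 ≤ Real.log K / a.eta := div_nonneg (Real.log_natCast_nonneg _) hη.le
  have hocc : 0 ≤ a.Z * (c₀ * √(a.T * Real.log (d + 1))) := by positivity
  have hrew := hR.meanScore_borda_le ha.two_le_K
  have hN := hR.meanActive_le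
  have hN' := hR.le_meanActive ha
  have hfull := hR.meanScore_fullScore ha.two_le_K
  have hexp := hR.gamma_mul_meanActive_le ha
  set N := meanActive a μ x y z
  set V := meanScore E.borda a μ x y z
  have hZB : a.Z * a.B ≤ 1 / 250000 * a.B := mul_le_mul_of_nonneg_right hsmall hB.le
  have hN0 : 0 ≤ N := by linarith
  have hV0 : 0 ≤ V := (mul_nonneg hγ.le hN0).trans hexp
  unfold regret
  -- `roundError a ≤ 3246 γ`, which is `1 / 8` for `γ = 1 / 25968`
  rcases le_or_gt a.gamma (1 / 25968) with hg | hg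
  · have herr : roundError a ≤ 1 / 8 := by
      have h1 : a.gamma * a.Z ≤ a.gamma := mul_le_of_le_one_right hγ.le (by linarith)
      have h2 : (a.gamma * a.Z) ^ 2 ≤ a.gamma := by
        rw [sq]
        exact (mul_le_of_le_one_right (by positivity) ha.gamma_mul_Z_le_one).trans h1
      unfold roundError
      nlinarith
    obtain ⟨i, hi⟩ := E.exists_half_le_borda ha.two_le_K
    have hm : ∀ l ∈ dualSet d, 2 * E.fullScore i - 2 * a.Z ≤
        ∑ k, ind i k * meanLagrangian a E l k := fun l hl => by
      rw [sum_ind_mul]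
      exact (meanLagrangian_mem a E hZ0.le ha.ratio_nonneg ha.ratio_le_two hl i).1
    have hmain := hR.le_meanScore ha hA (fun k => ind_nonneg i k) (by simp [ind]) hm
    rw [hfull, E.fullScore_eq ha.two_le_K] at hmain
    set k1 := ((K : ℝ) - 1) / K with hk1
    have hk1' : 1 / 2 ≤ k1 := by rw [hk1, div_le_div_iff₀ two_pos (by linarith)]; linarith
    have hk1'' : k1 ≤ 1 := by rw [hk1, div_le_one (by linarith)]; linarith
    have h1 : 0 ≤ a.Z * a.B * (1 - N / a.T) := mul_nonneg (by positivity) (by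
      rw [sub_nonneg, div_le_one hT]; exact hN)
    have h2 : k1 * V ≤ V := mul_le_of_le_one_left hV0 hk1''
    have h3 : 1 / 2 ≤ 2 * (k1 * E.borda i) := by nlinarith
    have h4 : (1 / 4 + 1 / K) * N ≤
        (2 * (k1 * E.borda i + 1 / (2 * K)) - 2 * a.Z - roundError a) * N := by
      refine mul_le_mul_of_nonneg_right ?_ hN0
      have e : 2 * (k1 * E.borda i + 1 / (2 * (K : ℝ))) = 2 * (k1 * E.borda i) + 1 / K := by
        field_simp
      rw [e]; linarith
    linarith
  · have h1 : 1 / 25968 * N ≤ a.gamma * N := mul_le_mul_of_nonneg_right hg.le hN0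
    linarith

end Run

/-- The choice of `η` says that `η K Z s² = u²`, where `u = (K log K)^(1/3)` and `s = T^(1/3)`. -/
theorem eta_mul_eq {K T : ℕ} (hK : 2 ≤ K) (hT : 1 ≤ T) {Z : ℝ} (hZ : 0 < Z) :
    (Real.log K / (T * √K)) ^ (2 / 3 : ℝ) * (1 / Z) * K * Z *
      ((T : ℝ) ^ (1 / 3 : ℝ)) ^ 2 = ((K * Real.log K : ℝ) ^ (1 / 3 : ℝ)) ^ 2 := by
  have hK' : (0 : ℝ) < K := by positivity
  have hT' : (0 : ℝ) < T := by exact_mod_cast hT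
  have hlog : 0 < Real.log K := Real.log_pos (by exact_mod_cast hK)
  have h2 : ∀ r : ℝ, 0 ≤ r → (r ^ (1 / 3 : ℝ)) ^ 2 = r ^ (2 / 3 : ℝ) := fun r hr => by
    rw [← Real.rpow_natCast, ← Real.rpow_mul hr]; norm_num
  rw [h2 _ hT'.le, h2 _ (by positivity), Real.div_rpow hlog.le (by positivity),
    Real.mul_rpow hT'.le (Real.sqrt_nonneg _), Real.mul_rpow hK'.le hlog.le,
    Real.sqrt_eq_rpow, ← Real.rpow_mul hK'.le]
  have h3 : (K : ℝ) = K ^ (1 / 2 * (2 / 3) : ℝ) * K ^ (2 / 3 : ℝ) := by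
    rw [← Real.rpow_add hK']; norm_num
  have h4 : (0 : ℝ) < T ^ (2 / 3 : ℝ) := by positivity
  have h5 : (0 : ℝ) < (K : ℝ) ^ (1 / 2 * (2 / 3) : ℝ) := by positivity
  set A := (K : ℝ) ^ (1 / 2 * (2 / 3) : ℝ)
  set A' := (K : ℝ) ^ (2 / 3 : ℝ)
  rw [h3]
  field_simp

/-- The error terms `γ Z T` and `(γ Z)² T`, with `T = s³`, against `Z u² s²`. The first bound needs
a lower bound on `Z`. -/
theorem error_terms_le {γ Z u s : ℝ} (hγ : 0 < γ) (hZ : 1 / 250000 ≤ Z) (hu : 1 ≤ u) (hs : 1 ≤ s)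
    (h : γ ^ 2 * Z * s ^ 2 = u ^ 2) :
    γ * Z * s ^ 3 ≤ 500 * (Z * (u ^ 2 * s ^ 2)) ∧
      (γ * Z) ^ 2 * s ^ 3 ≤ Z * (u ^ 2 * s ^ 2) := by
  have hZ0 : 0 < Z := by linarith
  constructor
  · refine (pow_le_pow_iff_left₀ (by positivity) (by positivity) two_ne_zero).1 ?_
    have e : (γ * Z * s ^ 3) ^ 2 = Z * s ^ 4 * u ^ 2 := by rw [← h]; ring
    rw [e]
    have h1 : 1 ≤ 250000 * Z * u ^ 2 := by nlinarith [one_le_pow₀ hu (n := 2)]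
    calc Z * s ^ 4 * u ^ 2 ≤ Z * s ^ 4 * u ^ 2 * (250000 * Z * u ^ 2) :=
          le_mul_of_one_le_right (by positivity) h1
      _ = _ := by ring
  · have e : (γ * Z) ^ 2 * s ^ 3 = Z * u ^ 2 * s := by rw [← h]; ring
    rw [e]
    calc Z * u ^ 2 * s ≤ Z * u ^ 2 * s ^ 2 :=
          mul_le_mul_of_nonneg_left (by nlinarith) (by positivity)
      _ = _ := by ring

theorem one_le_mul_log {K : ℕ} (hK : 2 ≤ K) : 1 ≤ (K : ℝ) * Real.log K := by
  have hK' : (2 : ℝ) ≤ K := by exact_mod_cast hK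
  have h1 : Real.log 2 ≤ Real.log K := Real.log_le_log two_pos hK'
  nlinarith [Real.log_two_gt_d9]

end BordaDBwK

end

theorem mainTheorem1 (κ c₀ : ℝ) (hκ : 1 ≤ κ) (hc₀ : 0 < c₀) :
    ∃ (C : ℝ) (p : ℕ), 0 < C ∧
      ∀ (K d T : ℕ) (B Z : ℝ) (E : BordaDBwK.Instance K d) (oco : BordaDBwK.OCO d),
        2 ≤ K → 1 ≤ T → 0 < B → B ≤ 2 * T →
        (E.feasible B T).Nonempty →
        0 < Z → E.opt B T / B ≤ Z → Z ≤ κ * (E.opt B T / B) →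
        oco.HasRegret T c₀ →
        ∀ η γ : ℝ,
          η = (Real.log K / (T * √K)) ^ (2 / 3 : ℝ) * (1 / Z) → γ = √(η * K) → γ < 1 →
          ∀ {Ω : Type*} [MeasurableSpace Ω] (μ : MeasureTheory.Measure Ω)
            [MeasureTheory.IsProbabilityMeasure μ]
            (x y : ℕ → Ω → Fin K) (z : ℕ → Ω → BordaDBwK.Outcome K d),
            BordaDBwK.IsRun E ⟨η, γ, Z, B, T, oco⟩ μ x y z →
            BordaDBwK.regret E ⟨η, γ, Z, B, T, oco⟩ μ x y z ≤
              C * Real.log (T + d + 1) ^ p *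
                (E.opt B T / B * (K * Real.log K) ^ (2 / 3 : ℝ) * (T : ℝ) ^ (2 / 3 : ℝ)) := by
  -- The error terms of `IsRun.regret_le` have numerical constants whose sum is below `10 ^ 12 / 2`.
  refine ⟨κ * (10 ^ 12 + 4 * c₀), 1, by positivity, ?_⟩
  intro K d T B Z E oco hK hT hB hBT hne hZ hρZ hZκ hoco η γ hη hγ hγ1 Ω _ μ _ x y z hR
  have hK2 : (2 : ℝ) ≤ K := by exact_mod_cast hK
  have hT1 : (1 : ℝ) ≤ T := by exact_mod_cast hT
  have hlogK : 0 < Real.log K := Real.log_pos (by linarith)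
  have hKL := BordaDBwK.one_le_mul_log hK
  set u : ℝ := (K * Real.log K : ℝ) ^ (1 / 3 : ℝ) with hu
  set s : ℝ := (T : ℝ) ^ (1 / 3 : ℝ) with hs
  have hu1 : 1 ≤ u := Real.one_le_rpow hKL (by norm_num)
  have hs1 : 1 ≤ s := Real.one_le_rpow hT1 (by norm_num)
  have hu3 : u ^ 3 = K * Real.log K := by
    rw [hu, ← Real.rpow_natCast, ← Real.rpow_mul (by linarith)]; norm_num
  have hs3 : s ^ 3 = T := by
    rw [hs, ← Real.rpow_natCast, ← Real.rpow_mul (by linarith)]; norm_num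
  have hu2 : (K * Real.log K : ℝ) ^ (2 / 3 : ℝ) = u ^ 2 := by
    rw [hu, ← Real.rpow_natCast, ← Real.rpow_mul (by linarith)]; norm_num
  have hs2 : (T : ℝ) ^ (2 / 3 : ℝ) = s ^ 2 := by
    rw [hs, ← Real.rpow_natCast, ← Real.rpow_mul (by linarith)]; norm_num
  have hηu : η * K * Z * s ^ 2 = u ^ 2 := by rw [hη]; exact BordaDBwK.eta_mul_eq hK hT hZ
  have hη0 : 0 < η := by rw [hη]; positivity
  have hγ0 : 0 < γ := by rw [hγ]; positivity
  have hηγ : η * K = γ ^ 2 := by rw [hγ, Real.sq_sqrt (by positivity)]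
  have hγu : γ ^ 2 * Z * s ^ 2 = u ^ 2 := by rw [← hηγ]; exact hηu
  have hlogη : Real.log K / η = Z * (u * s ^ 2) := by
    rw [div_eq_iff hη0.ne']
    have h1 : (K : ℝ) * u ^ 2 * Real.log K = K * u ^ 2 * (Z * (u * s ^ 2) * η) := by
      calc (K : ℝ) * u ^ 2 * Real.log K = u ^ 2 * u ^ 3 := by rw [hu3]; ring
        _ = u ^ 3 * (η * K * Z * s ^ 2) := by rw [hηu]; ring
        _ = _ := by ring
    exact mul_left_cancel₀ (by positivity) h1
  rw [hu2, hs2, pow_one]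
  set ρ := E.opt B T / B with hρ
  have hopt : E.opt B T = ρ * B := by rw [hρ]; field_simp
  set L := Real.log (T + d + 1) with hL
  have hd0 : (0 : ℝ) ≤ d := Nat.cast_nonneg _
  have hL1 : 1 / 2 ≤ L := by
    have h1 : Real.log 2 ≤ L := Real.log_le_log two_pos (by linarith)
    linarith [Real.log_two_gt_d9]
  have hρ0 : 0 < ρ := pos_of_mul_pos_right (hZ.trans_le hZκ) (by linarith)
  set W := ρ * u ^ 2 * s ^ 2 with hW
  have hW0 : 0 < W := by positivity
  have hZW : Z * (u ^ 2 * s ^ 2) ≤ κ * W := by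
    calc Z * (u ^ 2 * s ^ 2) ≤ κ * ρ * (u ^ 2 * s ^ 2) :=
          mul_le_mul_of_nonneg_right hZκ (by positivity)
      _ = κ * W := by rw [hW]; ring
  have hκW : 0 < κ * W := by positivity
  have hLκW : κ * W ≤ 2 * (L * (κ * W)) := by
    have := mul_le_mul_of_nonneg_right hL1 hκW.le
    linarith
  -- For a small budget the claim is weaker than `R(T) ≤ OPT`.
  rcases le_or_gt B (2 * κ * (u ^ 2 * s ^ 2)) with hsmall | hlarge
  · have h1 := BordaDBwK.regret_le_opt E hK ⟨η, γ, Z, B, T, oco⟩ μ x y z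
    have h2 : E.opt B T ≤ 2 * (κ * W) := by
      rw [hopt, hW]
      calc ρ * B ≤ ρ * (2 * κ * (u ^ 2 * s ^ 2)) := mul_le_mul_of_nonneg_left hsmall hρ0.le
        _ = _ := by ring
    have h3 : 0 < c₀ * (L * (κ * W)) := by positivity
    calc _ ≤ 2 * (κ * W) := h1.trans h2
      _ ≤ 10 ^ 12 * (L * (κ * W)) + 4 * (c₀ * (L * (κ * W))) := by linarith
      _ = _ := by ring
  -- A large budget bounds `Z`, since `Z ≤ κ OPT / B ≤ 2 κ T / B`; hence `γ Z ≤ 1`.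
  have hZs : Z * u ^ 2 ≤ s := by
    have h1 := E.opt_le_two_mul hK hT hne
    rw [hopt, ← hs3] at h1
    have h2 : κ * ρ * B ≤ κ * (2 * s ^ 3) := by
      rw [mul_assoc]; exact mul_le_mul_of_nonneg_left h1 (by linarith)
    have h3 : Z * B ≤ κ * (2 * s ^ 3) := (mul_le_mul_of_nonneg_right hZκ hB.le).trans h2
    have h4 : Z * (2 * κ * (u ^ 2 * s ^ 2)) ≤ Z * B := mul_le_mul_of_nonneg_left hlarge.le hZ.le
    have h5 : 2 * κ * s ^ 2 * (Z * u ^ 2) ≤ 2 * κ * s ^ 2 * s := by linarith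
    exact le_of_mul_le_mul_left h5 (by positivity)
  have hγZ : γ * Z ≤ 1 := by
    refine (pow_le_pow_iff_left₀ (by positivity) zero_le_one two_ne_zero).1 ?_
    have h1 : (γ * Z) ^ 2 * s ^ 2 = Z * u ^ 2 := by rw [← hγu]; ring
    have h2 : s ≤ s ^ 2 := le_self_pow₀ hs1 two_ne_zero
    have h3 : s ^ 2 * (γ * Z) ^ 2 ≤ s ^ 2 * 1 ^ 2 := by linarith
    exact le_of_mul_le_mul_left h3 (by positivity)
  have ha : (⟨η, γ, Z, B, T, oco⟩ : BordaDBwK.Params d).Valid K :=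
    ⟨hK, hT, hB, hBT, hZ, hη0, hγ0, hγ1, hηγ, hγZ⟩
  have hZopt : E.opt B T ≤ Z * B := by
    rw [hopt]; exact mul_le_mul_of_nonneg_right hρZ hB.le
  -- `γ < 1` forces `u² ≤ Z s²`, so that additive constants are absorbed.
  have hone : 1 ≤ Z * (u ^ 2 * s ^ 2) := by
    have h1 : u ^ 2 ≤ Z * s ^ 2 := by
      rw [← hγu, mul_assoc]
      exact mul_le_of_le_one_left (by positivity) (pow_le_one₀ hγ0.le hγ1.le)
    have h2 : 1 ≤ u ^ 2 := one_le_pow₀ hu1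
    calc 1 ≤ u ^ 2 * (Z * s ^ 2) := one_le_mul_of_one_le_of_one_le h2 (h2.trans h1)
      _ = _ := by ring
  have hlogη' : Real.log K / η ≤ Z * (u ^ 2 * s ^ 2) := by
    rw [hlogη]
    exact mul_le_mul_of_nonneg_left
      (mul_le_mul_of_nonneg_right (le_self_pow₀ hu1 two_ne_zero) (by positivity)) hZ.le
  have hdual : Z * (c₀ * √(T * Real.log (d + 1))) ≤ 2 * (c₀ * (L * (κ * W))) := by
    have h1 : √(T * Real.log (d + 1)) ≤ 2 * L * s ^ 2 := by
      refine Real.sqrt_le_iff.2 ⟨by positivity, ?_⟩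
      have h2 : Real.log (d + 1) ≤ L := Real.log_le_log (by linarith) (by linarith)
      have h3 : 0 ≤ Real.log ((d : ℝ) + 1) := Real.log_nonneg (by linarith)
      calc T * Real.log (d + 1) ≤ s ^ 4 * (4 * L ^ 2) := by
            have h4 : L * 1 ≤ L * (4 * L) := mul_le_mul_of_nonneg_left (by linarith) (by linarith)
            refine mul_le_mul ?_ (by linarith) h3 (by positivity)
            rw [← hs3]; exact pow_le_pow_right₀ hs1 (by norm_num)
        _ = _ := by ring
    calc Z * (c₀ * √(T * Real.log (d + 1))) ≤ Z * (c₀ * (2 * L * s ^ 2)) := by gcongr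
      _ = 2 * c₀ * L * (Z * (1 * s ^ 2)) := by ring
      _ ≤ 2 * c₀ * L * (Z * (u ^ 2 * s ^ 2)) := by
          gcongr
          exact one_le_pow₀ hu1
      _ ≤ 2 * c₀ * L * (κ * W) := by gcongr
      _ = _ := by ring
  have hfin : κ * (10 ^ 12 + 4 * c₀) * L * W =
      10 ^ 12 * (L * (κ * W)) + 4 * (c₀ * (L * (κ * W))) := by ring
  have hpos : 0 < c₀ * (L * (κ * W)) := by positivity
  rw [hfin]
  rcases le_or_gt Z (1 / 250000) with hZs' | hZl
  · have h1 := hR.regret_le_of_Z_small ha hc₀.le hoco hZopt hZs'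
    dsimp only at h1
    linarith
  · have h1 := hR.regret_le ha hc₀.le hoco hne hZopt
    obtain ⟨e1, e2⟩ := BordaDBwK.error_terms_le hγ0 hZl.le hu1 hs1 hγu
    have h2 : BordaDBwK.roundError (⟨η, γ, Z, B, T, oco⟩ : BordaDBwK.Params d) * T =
        1298 * (γ * s ^ 3) + 4 * (γ * Z * s ^ 3) + 1944 * ((γ * Z) ^ 2 * s ^ 3) := by
      rw [hs3]; simp only [BordaDBwK.roundError]; ring
    have h3 : γ * s ^ 3 ≤ 250000 * (γ * Z * s ^ 3) := by
      have : γ * s ^ 3 * 1 ≤ γ * s ^ 3 * (250000 * Z) :=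
        mul_le_mul_of_nonneg_left (by linarith) (by positivity)
      linarith
    dsimp only at h1
    rw [h2] at h1
    linarith
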